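/- Let $a,c\in\mathbb C$ with $a\neq 1$ and $2a\neq 3$, and suppose that the sextic $$F(x)=x(x-1)\left(x-\frac{a(a-2)}{2a-3}\right)\left(x^3-ax^2+\left(\frac{(2a-3)c}{(a-1)^2}+\frac{a^2}{4}\right)x-c\right)$$ has no repeated root, so that $C:\ Y^2=F(x)$ is a curve of genus $2$ (curves are identified with their smooth projective models over $\mathbb C$). Put $$t=\frac{a^3(a-2)}{(2a-3)^3},\qquad s=\frac{4c}{(a-1)^2}.$$ Then $0,1,t,s$ are pairwise distinct, so that $E_1:\ y^2=z(z-1)(z-t)(z-s)$ is an elliptic curve, and there is a covering $\psi:C\to E_1$ of degree $3$ which is maximal and of generic type. Here $\psi$ is *maximal* if it does not factor over a nontrivial isogeny: whenever $\psi=\beta\circ\psi'$ with coverings $\psi':C\to E'$ and $\beta:E'\to E_1$, where $E'$ is an elliptic curve, $\beta$ is an isomorphism. The covering $\psi$ of degree $3$ is of *generic type* if the following two conditions hold. (1) There are points $P_1,P_2\in C$ with $\psi(P_1)\neq\psi(P_2)$ at which $\psi$ has ramification index $2$, and $\psi$ is unramified at all other points of $C$. (2) There is a covering $\phi:\mathbb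 P^1\to\mathbb P^1$ of degree $3$ (the Frey-Kani covering of $\psi$) with $\phi\circ\pi_C=\pi_{E_1}\circ\psi$, where $\pi_C(x,Y)=x$ and $\pi_{E_1}(z,y)=z$ are the natural projections to $\mathbb P^1$. Its ramification is as follows. The four branch points of $\pi_{E_1}$ can be numbered $q_1,\dots,q_4$ so that each of the fibres of $\phi$ over $q_1,q_2,q_3$ contains exactly one point of ramification index $2$ and is otherwise unramified, and the fibre over $q_4$ is unramified. There is a fifth point $q_5\notin\{q_1,\dots,q_4\}$ whose fibre contains exactly one point of ramification index $2$ and is otherwise unramified. Over all other points $\phi$ is unramified. -/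

import Mathlib

open Polynomial

noncomputable section

/-! ## Curves, points and coverings

A smooth projective curve over `ℂ` is given by its function field `K`: the points of the curve are
the valuation rings of `K` over `ℂ` other than `K` itself, and a covering `C → E` is a `ℂ`-embedding
`ℂ(E) → ℂ(C)` of function fields. -/

/-- The points of the smooth projective curve over `ℂ` with function field `K`. -/
def points (K : Type) [Field K] [Algebra ℂ K] : Set (ValuationSubring K) :=
  {P | (∀ r : ℂ, algebraMap ℂ K r ∈ P) ∧ P ≠ ⊤}

section Covering

variable {K L : Type} [Field K] [Algebra ℂ K] [Field L] [Algebra ℂ L]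

/-- The image of the point `P` under the covering with comorphism `ψ : K → L`. -/
def image (ψ : K →ₐ[ℂ] L) (P : ValuationSubring L) : ValuationSubring K :=
  P.comap ψ.toRingHom

/-- The map of local rings `O_{ψ(P)} → O_P`. -/
def localMap (ψ : K →ₐ[ℂ] L) (P : ValuationSubring L) : image ψ P →+* P :=
  ψ.toRingHom.restrict (image ψ P) P (fun _ h => h)

/-- The ramification index of the covering `ψ` at `P`: the largest `e` with
`m_{ψ(P)} O_P ⊆ m_P ^ e`. -/
def ramIndex (ψ : K →ₐ[ℂ] L) (P : ValuationSubring L) : ℕ :=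
  sSup {e : ℕ | (IsLocalRing.maximalIdeal (image ψ P)).map (localMap ψ P) ≤
    IsLocalRing.maximalIdeal P ^ e}

/-- The degree of the covering `ψ`. -/
def coverDegree (ψ : K →ₐ[ℂ] L) : ℕ :=
  Module.finrank ψ.fieldRange L

/-- The branch points of the covering `ψ`. -/
def branchPoints (ψ : K →ₐ[ℂ] L) : Set (ValuationSubring K) :=
  {q | ∃ P ∈ points L, image ψ P = q ∧ ramIndex ψ P ≠ 1}

/-- The fibre of `ψ` over `q` is of type `(2)^k`: it contains exactly `k` points of ramification
index `2`, and all other points in it are unramified. -/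
def FibreType (ψ : K →ₐ[ℂ] L) (q : ValuationSubring K) (k : ℕ) : Prop :=
  {P | P ∈ points L ∧ image ψ P = q ∧ ramIndex ψ P = 2}.encard = k ∧
  ∀ P ∈ points L, image ψ P = q → ramIndex ψ P = 1 ∨ ramIndex ψ P = 2

/-- `K` is the function field of an elliptic curve over `ℂ`. -/
def IsEllipticFunctionField (K : Type) [Field K] [Algebra ℂ K] : Prop :=
  ∃ W : WeierstrassCurve ℂ, W.IsElliptic ∧ Nonempty (K ≃ₐ[ℂ] W.toAffine.FunctionField)

/-- A covering `ψ : C → E` of an elliptic curve is maximal if it does not factor over a nontrivial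
isogeny: whenever `ψ = β ∘ ψ'` with `ψ' : C → E'`, `β : E' → E` and `E'` an elliptic curve, `β` is
an isomorphism. (A nonconstant `β` is an isogeny once the origin of `E` is moved to
the image of the origin of `E'`.) -/
def IsMaximalCover (ψ : K →ₐ[ℂ] L) : Prop :=
  ∀ W : WeierstrassCurve ℂ, W.IsElliptic →
    ∀ (β : K →ₐ[ℂ] W.toAffine.FunctionField) (ψ' : W.toAffine.FunctionField →ₐ[ℂ] L),
      ψ = ψ'.comp β → Function.Bijective β

end Covering

/-! ## Double covers of the projective line -/

/-- The function field `ℂ(x)(√F)` of the curve `Y² = F(x)`, as the splitting field of `T² - F`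
over `ℂ(x)`. -/
abbrev CurveField (F : ℂ[X]) : Type :=
  SplittingField (X ^ 2 - C (algebraMap ℂ[X] (RatFunc ℂ) F))

/-- The natural projection `(x, Y) ↦ x` from the curve `Y² = F(x)` to the projective line. -/
def proj (F : ℂ[X]) : RatFunc ℂ →ₐ[ℂ] CurveField F :=
  IsScalarTower.toAlgHom ℂ (RatFunc ℂ) (CurveField F)

/-- `φ : ℙ¹ → ℙ¹` is the Frey-Kani covering of `ψ`, where `ψ` maps the curve `Y² = F(x)` to the
curve `y² = G(z)`: the square formed by `ψ`, `φ` and the two natural projections commutes. -/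
def IsFreyKani {F G : ℂ[X]} (ψ : CurveField G →ₐ[ℂ] CurveField F)
    (φ : RatFunc ℂ →ₐ[ℂ] RatFunc ℂ) : Prop :=
  ψ.comp (proj G) = (proj F).comp φ

/-- The ramification of `ψ` is that of case I: there are exactly two ramified points, both of
index `2`, and they lie in different fibres. -/
def IsCaseOne {K L : Type} [Field K] [Algebra ℂ K] [Field L] [Algebra ℂ L]
    (ψ : K →ₐ[ℂ] L) : Prop :=
  ∃ P₁ ∈ points L, ∃ P₂ ∈ points L, image ψ P₁ ≠ image ψ P₂ ∧
    ramIndex ψ P₁ = 2 ∧ ramIndex ψ P₂ = 2 ∧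
    ∀ P ∈ points L, P ≠ P₁ → P ≠ P₂ → ramIndex ψ P = 1

/-- The covering `φ : ℙ¹ → ℙ¹` of odd degree `n` has the generic ramification
`((2)^((n-1)/2), (2)^((n-1)/2), (2)^((n-1)/2), (2)^((n-3)/2), (2)^1)`, where the first four places
are the branch points of `z : E → ℙ¹` on `E : y² = G(z)` (the images of the 2-torsion points) and
the fifth is another point; `φ` is unramified over all other points. -/
def HasGenericRamification (G : ℂ[X]) (φ : RatFunc ℂ →ₐ[ℂ] RatFunc ℂ) (n : ℕ) : Prop :=
  ∃ q : Fin 5 → ValuationSubring (RatFunc ℂ),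
    Function.Injective q ∧ (∀ i, q i ∈ points (RatFunc ℂ)) ∧
    branchPoints (proj G) = {q 0, q 1, q 2, q 3} ∧
    FibreType φ (q 0) ((n - 1) / 2) ∧ FibreType φ (q 1) ((n - 1) / 2) ∧
    FibreType φ (q 2) ((n - 1) / 2) ∧ FibreType φ (q 3) ((n - 3) / 2) ∧
    FibreType φ (q 4) 1 ∧
    ∀ P ∈ points (RatFunc ℂ), image φ P ∉ Set.range q → ramIndex φ P = 1

/-- The covering `ψ` of degree `n` (odd), from `Y² = F(x)` to `y² = G(z)`, is of generic type:
`ψ` is ramified as in case I and its Frey-Kani covering has degree `n` and generic ramification. -/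
def IsGenericType {F G : ℂ[X]} (ψ : CurveField G →ₐ[ℂ] CurveField F) (n : ℕ) : Prop :=
  IsCaseOne ψ ∧ ∃ φ : RatFunc ℂ →ₐ[ℂ] RatFunc ℂ,
    IsFreyKani ψ φ ∧ coverDegree φ = n ∧ HasGenericRamification G φ n

/-! ## The family -/

/-- The sextic `x(x-1)(x - a(a-2)/(2a-3))(x³ - ax² + ((2a-3)c/(a-1)² + a²/4)x - c)`. -/
def sextic (a c : ℂ) : ℂ[X] :=
  X * (X - 1) * (X - C (a * (a - 2) / (2 * a - 3))) *
    (X ^ 3 - C a * X ^ 2 + C ((2 * a - 3) * c / (a - 1) ^ 2 + a ^ 2 / 4) * X - C c)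

/-- The quartic `z(z-1)(z-t)(z-s)`. -/
def quartic (t s : ℂ) : ℂ[X] :=
  X * (X - 1) * (X - C t) * (X - C s)

end

/-!
The covering is explicit. Put `N = x(2x - a)²` and `D = (a - 1)² - (2a - 3)x`. The rational function
`φ = N / D` of degree `3` takes each of the values `0`, `1`, `t` doubly at one point, namely at a
root of `R = 2(2x - a)(2x - (a - 1))(2x - a(a - 1)/(2a - 3))`, and it has a double pole at infinity;
the roots of `φ - s` are those of the cubic factor of the sextic `F`. Hence
`N (N - D) (N - tD) (N - sD) = F R²` (`Admissible.identity`), so that `z = φ(x)`,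
`y = Y R(x) / D(x)²` maps `Y² = F(x)` to `y² = z(z-1)(z-t)(z-s)`. The degree of this map is `3`
because degrees of coverings are multiplicative (`coverDegree_comp`).

Ramification indices are computed with uniformizers (`ramIndex_eq`). A function field generated by
`x` and `Y` with `Y² = F(x)` is called a model (`IsModel`); the rational function field is the case
`F = Y = 1`, and the points at infinity are finite points of the model in `1/x`. At a point with
`x = x₀` a uniformizer is `x - x₀` if `F(x₀) ≠ 0`, and `Y` if `x₀` is a simple root of `F`
(`IsModel.local_of_ne`, `IsModel.local_of_eq`). This rests on `isUniformizer_and_localization`: a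
valuation ring that contains a Noetherian ring whose local ring at the centre has a principal maximal
ideal is that local ring. The Wronskian `N'D - ND'` is a multiple of `R`, whose roots are simple, so
`φ` is ramified to order `2` exactly at these roots and at infinity. On the curve, the ramification
at the roots of `R` is absorbed by the ramification of `z`, and only the two points over `x = ∞`
remain.

For maximality, a factorization through an elliptic curve has a factor of degree `1`, as `3` is
prime. If the first factor has degree `1`, then the curve `Y² = F(x)` is elliptic. The function field
of an elliptic curve has a nonzero derivation that preserves all its local rings, the one dual to the
invariant differential (`exists_regularDerivation`). The field of `Y² = F(x)` has none
(`IsModel.regularDerivation_eq_zero`): for such a derivation `δ`, the function `δ(x)/Y` has no poles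
and vanishes over `x = ∞`, so it is zero.
-/

noncomputable section

/-! ### Uniformizers of a valuation ring -/

section Uniformizer

variable {L : Type} [Field L]

/-- `π` is a uniformizer of `P`: it generates the maximal ideal, and it is not zero. -/
def IsUniformizer (P : ValuationSubring L) (π : L) : Prop :=
  π ≠ 0 ∧ P.valuation π < 1 ∧ ∀ g : L, P.valuation g < 1 → P.valuation g ≤ P.valuation π

lemma IsUniformizer.maximalIdeal_eq {P : ValuationSubring L} {π : L} (h : IsUniformizer P π)
    (hπ : π ∈ P) : IsLocalRing.maximalIdeal P = Ideal.span {(⟨π, hπ⟩ : P)} := by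
  apply le_antisymm
  · intro g hg
    rw [P.valuation_lt_one_iff] at hg
    obtain ⟨b, hb⟩ := (P.valuation_le_iff _ _).1 (h.2.2 _ hg)
    rw [Ideal.mem_span_singleton']
    exact ⟨b, Subtype.ext hb⟩
  · rw [Ideal.span_singleton_le_iff_mem, P.valuation_lt_one_iff]
    exact h.2.1

variable {K : Type} [Field K] [Algebra ℂ K] [Algebra ℂ L]

lemma mem_image_iff (ψ : K →ₐ[ℂ] L) (P : ValuationSubring L) (g : K) :
    g ∈ image ψ P ↔ ψ g ∈ P := Iff.rfl

lemma image_valuation_lt_one_iff (ψ : K →ₐ[ℂ] L) (P : ValuationSubring L) (g : K) :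
    (image ψ P).valuation g < 1 ↔ P.valuation (ψ g) < 1 := by
  rw [← ValuationSubring.mem_nonunits_iff, ← ValuationSubring.mem_nonunits_iff,
    ValuationSubring.mem_nonunits_iff_or, ValuationSubring.mem_nonunits_iff_or, mem_image_iff,
    map_inv₀, map_eq_zero]

/-- The ramification index is the exponent that relates uniformizers. -/
theorem ramIndex_eq {ψ : K →ₐ[ℂ] L} {P : ValuationSubring L} {π : K} {ϖ : L} (e : ℕ)
    (hπ : IsUniformizer (image ψ P) π) (hϖ : IsUniformizer P ϖ)
    (h : P.valuation (ψ π) = P.valuation ϖ ^ e) : ramIndex ψ P = e := by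
  have hπm : π ∈ image ψ P := (ValuationSubring.valuation_le_one_iff _ _).1 hπ.2.1.le
  have hϖm : ϖ ∈ P := (ValuationSubring.valuation_le_one_iff _ _).1 hϖ.2.1.le
  have key : ∀ k : ℕ, (IsLocalRing.maximalIdeal (image ψ P)).map (localMap ψ P) ≤
      IsLocalRing.maximalIdeal P ^ k ↔ k ≤ e := by
    intro k
    rw [hπ.maximalIdeal_eq hπm, hϖ.maximalIdeal_eq hϖm, Ideal.map_span, Set.image_singleton,
      Ideal.span_singleton_pow, Ideal.span_singleton_le_span_singleton]
    have h1 : ((⟨ϖ, hϖm⟩ : P) ^ k ∣ localMap ψ P ⟨π, hπm⟩) ↔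
        P.valuation (ψ π) ≤ P.valuation (ϖ ^ k) := by
      rw [P.valuation_le_iff]
      constructor
      · rintro ⟨b, hb⟩
        refine ⟨b, ?_⟩
        have := congrArg Subtype.val hb
        rw [mul_comm]
        exact this.symm
      · rintro ⟨b, hb⟩
        refine ⟨b, Subtype.ext ?_⟩
        rw [mul_comm] at hb
        exact hb.symm
    rw [h1, h, map_pow]
    have h0 : 0 < P.valuation ϖ := by
      rw [zero_lt_iff, ne_eq, map_eq_zero]; exact hϖ.1
    exact pow_le_pow_iff_right_of_lt_one₀ h0 hϖ.2.1
  unfold ramIndex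
  have : {k : ℕ | (IsLocalRing.maximalIdeal (image ψ P)).map (localMap ψ P) ≤
      IsLocalRing.maximalIdeal P ^ k} = Set.Iic e := Set.ext key
  rw [this, csSup_Iic]

end Uniformizer

/-! ### Valuation rings over a finitely generated algebra -/

section LocalRing

variable {L : Type} [Field L] [Algebra ℂ L]

/-- Let `A` be a Noetherian subalgebra of the valuation ring `P`, and let `π` generate the maximal
ideal of the localization of `A` at the centre of `P`. Every nonzero element of `A` is a power of
`π` times a unit of this localization. -/
lemma exists_pow_mul_unit (P : ValuationSubring L) (A : Subalgebra ℂ L) [IsNoetherianRing A]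
    {π : L} (hπA : π ∈ A) (hπ : P.valuation π < 1) (hA : ∀ r ∈ A, r ∈ P)
    (H : ∀ r ∈ A, P.valuation r < 1 → ∃ s ∈ A, ∃ r' ∈ A, P.valuation s = 1 ∧ s * r = π * r')
    (r : L) (hr : r ∈ A) (hr0 : r ≠ 0) :
    ∃ n : ℕ, ∃ s ∈ A, ∃ r' ∈ A, P.valuation s = 1 ∧ P.valuation r' = 1 ∧ s * r = π ^ n * r' := by
  by_contra hcon
  push Not at hcon
  have step : ∀ n : ℕ, ∃ s ∈ A, ∃ r' ∈ A, P.valuation s = 1 ∧ s * r = π ^ n * r' := by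
    intro n
    induction n with
    | zero => exact ⟨1, A.one_mem, r, hr, map_one _, by simp⟩
    | succ n ih =>
      obtain ⟨s, hs, r', hr', hs1, he⟩ := ih
      have hlt : P.valuation r' < 1 :=
        lt_of_le_of_ne ((P.valuation_le_one_iff _).2 (hA _ hr'))
          (fun h => hcon n s hs r' hr' hs1 h he)
      obtain ⟨s', hs', r'', hr'', hs1', he'⟩ := H r' hr' hlt
      refine ⟨s' * s, A.mul_mem hs' hs, r'', hr'', by rw [map_mul, hs1, hs1', one_mul], ?_⟩
      rw [mul_assoc, he, pow_succ, mul_assoc, ← he']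
      ring
  choose s hs r' hr' hs1 he using step
  -- the ideals of those `f` for which `π ^ n * f` is a multiple of `r` in the localization
  let J : ℕ →o Ideal A :=
    { toFun := fun n =>
        { carrier := {f | ∃ u ∈ A, ∃ b ∈ A, P.valuation u = 1 ∧ u * π ^ n * (f : L) = r * b}
          add_mem' := by
            rintro f g ⟨u, hu, b, hb, hu1, h⟩ ⟨u', hu', b', hb', hu1', h'⟩
            refine ⟨u * u', A.mul_mem hu hu', u' * b + u * b',
              A.add_mem (A.mul_mem hu' hb) (A.mul_mem hu hb'), by rw [map_mul, hu1, hu1', one_mul],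
              ?_⟩
            push_cast
            linear_combination u' * h + u * h'
          zero_mem' := ⟨1, A.one_mem, 0, A.zero_mem, map_one _, by simp⟩
          smul_mem' := by
            rintro k f ⟨u, hu, b, hb, hu1, h⟩
            refine ⟨u, hu, k * b, A.mul_mem k.2 hb, hu1, ?_⟩
            simp only [smul_eq_mul, MulMemClass.coe_mul]
            linear_combination (k : L) * h }
      monotone' := by
        refine monotone_nat_of_le_succ fun n => ?_
        rintro f ⟨u, hu, b, hb, hu1, h⟩
        refine ⟨u, hu, π * b, A.mul_mem hπA hb, hu1, ?_⟩
        linear_combination π * h }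
  obtain ⟨n, hn⟩ := monotone_stabilizes_iff_noetherian.2 (inferInstance : IsNoetherian A A) J
  have hmem : (⟨r' (n + 1), hr' (n + 1)⟩ : A) ∈ J (n + 1) :=
    ⟨1, A.one_mem, s (n + 1), hs _, map_one _, by rw [one_mul, ← he, mul_comm]⟩
  rw [← hn (n + 1) (Nat.le_succ n)] at hmem
  obtain ⟨u, hu, b, hb, hu1, h⟩ := hmem
  have h2 : u * s (n + 1) = π * b := by
    apply mul_right_cancel₀ hr0
    linear_combination u * he (n + 1) + π * h
  have h3 := congrArg P.valuation h2
  rw [map_mul, map_mul, hu1, hs1, one_mul] at h3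
  have : P.valuation π * P.valuation b < 1 :=
    mul_lt_one_of_lt_of_le hπ ((P.valuation_le_one_iff _).2 (hA _ hb))
  exact absurd h3.symm this.ne

/-- Under the hypotheses of `exists_pow_mul_unit`, the valuation ring `P` is the localization of `A`
at the centre of `P`, and `π` is a uniformizer. -/
theorem isUniformizer_and_localization (P : ValuationSubring L) (A : Subalgebra ℂ L)
    [IsNoetherianRing A]
    {π : L} (hπA : π ∈ A) (hπ0 : π ≠ 0) (hπ : P.valuation π < 1) (hA : ∀ r ∈ A, r ∈ P)
    (hfrac : ∀ g : L, ∃ r ∈ A, ∃ s ∈ A, g = r / s)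
    (H : ∀ r ∈ A, P.valuation r < 1 → ∃ s ∈ A, ∃ r' ∈ A, P.valuation s = 1 ∧ s * r = π * r') :
    IsUniformizer P π ∧ ∀ g ∈ P, ∃ r ∈ A, ∃ s ∈ A, P.valuation s = 1 ∧ g = r / s := by
  have hv0 : P.valuation π ≠ 0 := by simpa using hπ0
  have key : ∀ g : L, g ≠ 0 → ∃ n m : ℕ, ∃ a ∈ A, ∃ b ∈ A, P.valuation a = 1 ∧
      P.valuation b = 1 ∧ g = π ^ n / π ^ m * (a / b) := by
    intro g hg
    obtain ⟨r, hr, s, hs, rfl⟩ := hfrac g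
    have hr0 : r ≠ 0 := by rintro rfl; simp at hg
    have hs0 : s ≠ 0 := by rintro rfl; simp at hg
    obtain ⟨n, u, hu, r', hr', hu1, hr1, h⟩ := exists_pow_mul_unit P A hπA hπ hA H r hr hr0
    obtain ⟨m, w, hw, s', hs', hw1, hs1, h'⟩ := exists_pow_mul_unit P A hπA hπ hA H s hs hs0
    refine ⟨n, m, r' * w, A.mul_mem hr' hw, s' * u, A.mul_mem hs' hu, by simp [hr1, hw1],
      by simp [hs1, hu1], ?_⟩
    have hu0 : u ≠ 0 := by rintro rfl; simp at hu1
    have hw0 : w ≠ 0 := by rintro rfl; simp at hw1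
    have hs0' : s' ≠ 0 := by rintro rfl; simp at hs1
    field_simp
    linear_combination π ^ m * s' * h - π ^ n * r' * h'
  have hval : ∀ (n m : ℕ) (a b : L), P.valuation a = 1 → P.valuation b = 1 →
      P.valuation (π ^ n / π ^ m * (a / b)) = P.valuation π ^ n / P.valuation π ^ m := by
    intro n m a b ha hb
    simp [ha, hb]
  have hpos : 0 < P.valuation π := zero_lt_iff.2 hv0
  refine ⟨⟨hπ0, hπ, fun g hg => ?_⟩, fun g hg => ?_⟩
  · rcases eq_or_ne g 0 with rfl | hg0
    · simp
    obtain ⟨n, m, a, -, b, -, ha1, hb1, rfl⟩ := key g hg0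
    rw [hval _ _ _ _ ha1 hb1] at hg ⊢
    rw [div_lt_one₀ (pow_pos hpos m)] at hg
    have hmn := (pow_lt_pow_iff_right_of_lt_one₀ hpos hπ).1 hg
    obtain ⟨k, rfl⟩ := Nat.exists_eq_add_of_lt hmn
    have : P.valuation π ^ (m + k + 1) / P.valuation π ^ m = P.valuation π ^ k * P.valuation π := by
      rw [div_eq_iff (pow_ne_zero _ hv0), pow_succ, pow_add]
      ac_rfl
    rw [this]
    exact mul_le_of_le_one_left' (pow_le_one' hπ.le k)
  · rcases eq_or_ne g 0 with rfl | hg0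
    · exact ⟨0, A.zero_mem, 1, A.one_mem, map_one _, by simp⟩
    obtain ⟨n, m, a, ha, b, hb, ha1, hb1, rfl⟩ := key g hg0
    rw [← P.valuation_le_one_iff, hval _ _ _ _ ha1 hb1, div_le_one₀ (pow_pos hpos m),
      pow_le_pow_iff_right_of_lt_one₀ hpos hπ] at hg
    obtain ⟨k, rfl⟩ := Nat.exists_eq_add_of_le hg
    refine ⟨π ^ k * a, A.mul_mem (A.pow_mem hπA k) ha, b, hb, hb1, ?_⟩
    field_simp
    ring

end LocalRing

/-! ### Places of a double cover of the line -/

section Model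

variable {L : Type} [Field L] [Algebra ℂ L]

/-- `L` is generated over `ℂ` by a transcendental element `x` and an element `Y` with `Y² = F(x)`.
The element `Y` may lie in `ℂ(x)`, so that the rational function field, with `Y = 1`, is
included. -/
structure IsModel (F : ℂ[X]) (x Y : L) : Prop where
  eqn : Y ^ 2 = aeval x F
  gen : IntermediateField.adjoin ℂ {x, Y} = ⊤
  transc : Transcendental ℂ x

/-- The element `g` takes the value `r` at the place `P`. -/
def TakesValue (P : ValuationSubring L) (g : L) (r : ℂ) : Prop :=
  P.valuation (g - algebraMap ℂ L r) < 1

lemma takesValue_const (P : ValuationSubring L) (r : ℂ) : TakesValue P (algebraMap ℂ L r) r := by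
  simp [TakesValue]

lemma TakesValue.add {P : ValuationSubring L} {g g' : L} {r r' : ℂ} (h : TakesValue P g r)
    (h' : TakesValue P g' r') :
    TakesValue P (g + g') (r + r') := by
  have := P.valuation.map_add_lt h h'
  unfold TakesValue
  rw [map_add]
  convert this using 2
  ring

/-- The constants lie in `P`. -/
def ContainsConstants (P : ValuationSubring L) : Prop :=
  ∀ r : ℂ, algebraMap ℂ L r ∈ P

namespace ContainsConstants

variable {P : ValuationSubring L} (hP : ContainsConstants P)
include hP

lemma valuation_const {r : ℂ} (hr : r ≠ 0) : P.valuation (algebraMap ℂ L r) = 1 := by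
  apply le_antisymm ((P.valuation_le_one_iff _).2 (hP r))
  have h := (P.valuation_le_one_iff _).2 (hP r⁻¹)
  rw [map_inv₀, map_inv₀] at h
  have h0 : P.valuation (algebraMap ℂ L r) ≠ 0 := by simpa using hr
  exact (inv_le_one₀ (zero_lt_iff.2 h0)).1 h

lemma eq_zero_of_valuation_lt_one {r : ℂ} (h : P.valuation (algebraMap ℂ L r) < 1) : r = 0 := by
  by_contra hr
  exact h.ne (hP.valuation_const hr)

lemma valuation_le_one {g : L} {r : ℂ} (h : TakesValue P g r) : P.valuation g ≤ 1 := by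
  have := P.valuation.map_add (g - algebraMap ℂ L r) (algebraMap ℂ L r)
  rw [sub_add_cancel] at this
  exact this.trans (max_le h.le ((P.valuation_le_one_iff _).2 (hP r)))

lemma mem {g : L} {r : ℂ} (h : TakesValue P g r) : g ∈ P :=
  (P.valuation_le_one_iff _).1 (hP.valuation_le_one h)

lemma takesValue_mul {g g' : L} {r r' : ℂ} (h : TakesValue P g r) (h' : TakesValue P g' r') :
    TakesValue P (g * g') (r * r') := by
  have h1 : P.valuation ((g - algebraMap ℂ L r) * g') < 1 := by
    rw [map_mul]; exact mul_lt_one_of_lt_of_le h (hP.valuation_le_one h')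
  have h2 : P.valuation (algebraMap ℂ L r * (g' - algebraMap ℂ L r')) < 1 := by
    rw [map_mul, mul_comm]
    exact mul_lt_one_of_lt_of_le h' ((P.valuation_le_one_iff _).2 (hP r))
  have := P.valuation.map_add_lt h1 h2
  unfold TakesValue
  rw [map_mul]
  convert this using 2
  ring

lemma takesValue_neg {g : L} {r : ℂ} (h : TakesValue P g r) : TakesValue P (-g) (-r) := by
  simpa using hP.takesValue_mul (takesValue_const P (-1)) h

lemma takesValue_sub {g g' : L} {r r' : ℂ} (h : TakesValue P g r) (h' : TakesValue P g' r') :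
    TakesValue P (g - g') (r - r') := by
  simpa [sub_eq_add_neg] using h.add (hP.takesValue_neg h')

lemma takesValue_pow {g : L} {r : ℂ} (h : TakesValue P g r) (n : ℕ) :
    TakesValue P (g ^ n) (r ^ n) := by
  induction n with
  | zero => simpa using takesValue_const P 1
  | succ n ih => rw [pow_succ, pow_succ]; exact hP.takesValue_mul ih h

lemma takesValue_aeval {g : L} {r : ℂ} (h : TakesValue P g r) (p : ℂ[X]) :
    TakesValue P (aeval g p) (p.eval r) := by
  induction p using Polynomial.induction_on' with
  | add p q hp hq => rw [map_add, eval_add]; exact hp.add hq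
  | monomial n c =>
    rw [aeval_monomial, eval_monomial]
    exact hP.takesValue_mul (takesValue_const P c) (hP.takesValue_pow h n)

lemma valuation_eq_one {g : L} {r : ℂ} (h : TakesValue P g r) (hr : r ≠ 0) :
    P.valuation g = 1 := by
  apply le_antisymm (hP.valuation_le_one h)
  by_contra hlt
  rw [not_le] at hlt
  have h1 : P.valuation (g - (g - algebraMap ℂ L r)) < 1 := P.valuation.map_sub_lt hlt h
  rw [sub_sub_cancel] at h1
  exact hr (hP.eq_zero_of_valuation_lt_one h1)

lemma takesValue_inv {g : L} {r : ℂ} (h : TakesValue P g r) (hr : r ≠ 0) :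
    TakesValue P g⁻¹ r⁻¹ := by
  have hv := hP.valuation_eq_one h hr
  have hg : g ≠ 0 := by rintro rfl; simp at hv
  have hr' : algebraMap ℂ L r ≠ 0 := by simpa using hr
  have : g⁻¹ - algebraMap ℂ L r⁻¹ = -(g - algebraMap ℂ L r) / (g * algebraMap ℂ L r) := by
    rw [map_inv₀]
    field_simp
    ring
  unfold TakesValue
  rw [this, map_div₀, Valuation.map_neg, map_mul, hv, hP.valuation_const hr, one_mul, div_one]
  exact h

lemma takesValue_div {g g' : L} {r r' : ℂ} (h : TakesValue P g r) (h' : TakesValue P g' r')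
    (hr : r' ≠ 0) : TakesValue P (g / g') (r / r') := by
  rw [div_eq_mul_inv, div_eq_mul_inv]
  exact hP.takesValue_mul h (hP.takesValue_inv h' hr)

lemma takesValue_unique {g : L} {r r' : ℂ} (h : TakesValue P g r) (h' : TakesValue P g r') :
    r = r' := by
  have := hP.takesValue_sub h h'
  rw [sub_self, TakesValue, zero_sub, Valuation.map_neg] at this
  exact sub_eq_zero.1 (hP.eq_zero_of_valuation_lt_one this)

end ContainsConstants

lemma takesValue_zero {P : ValuationSubring L} {g : L} :
    TakesValue P g 0 ↔ P.valuation g < 1 := by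
  simp [TakesValue]

namespace IsModel

variable {F : ℂ[X]} {x Y : L} (M : IsModel F x Y)
include M

lemma exists_div (g : L) : ∃ r ∈ Algebra.adjoin ℂ {x, Y}, ∃ s ∈ Algebra.adjoin ℂ {x, Y},
    g = r / s := by
  have : g ∈ IntermediateField.adjoin ℂ {x, Y} := by rw [M.gen]; trivial
  exact IntermediateField.mem_adjoin_iff_div.1 this

lemma x_sub_ne_zero (r : ℂ) : x - algebraMap ℂ L r ≠ 0 := by
  intro h
  apply M.transc
  rw [sub_eq_zero] at h
  rw [h]
  exact isAlgebraic_algebraMap r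

lemma aeval_ne_zero {p : ℂ[X]} (hp : p ≠ 0) : aeval x p ≠ 0 :=
  fun h => M.transc ⟨p, hp, h⟩

variable {P : ValuationSubring L} (hP : ContainsConstants P)
include hP

lemma Y_mem (hx : x ∈ P) : Y ∈ P := by
  have hF : aeval x F ∈ P := by
    have hsub : Algebra.adjoin ℂ {x} ≤
        { P.toSubring with algebraMap_mem' := hP : Subalgebra ℂ L } :=
      Algebra.adjoin_le (by rw [Set.singleton_subset_iff]; exact hx)
    exact hsub (Polynomial.aeval_mem_adjoin_singleton ℂ x)
  rw [← P.valuation_le_one_iff] at hF ⊢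
  rw [← M.eqn, map_pow] at hF
  exact (pow_le_one_iff two_ne_zero).1 hF

/-- The residue field of a place is `ℂ`: otherwise `ℂ(x)`, over which `L` is algebraic, would be
contained in the valuation ring. -/
lemma exists_takesValue_x (hT : P ≠ ⊤) (hx : x ∈ P) : ∃ r, TakesValue P x r := by
  by_contra hcon
  push Not at hcon
  have h1 : ∀ r, P.valuation (x - algebraMap ℂ L r) = 1 := by
    intro r
    have hle : P.valuation (x - algebraMap ℂ L r) ≤ 1 :=
      (P.valuation_le_one_iff _).2 (sub_mem hx (hP r))
    exact le_antisymm hle (not_lt.1 (hcon r))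
  have h2 : ∀ p : ℂ[X], p ≠ 0 → P.valuation (aeval x p) = 1 := by
    intro p hp
    rw [(IsAlgClosed.splits p).eq_prod_roots]
    simp only [map_mul, aeval_C, map_multiset_prod, Multiset.map_map, Function.comp_def, map_sub,
      aeval_X, h1, Multiset.map_const', Multiset.prod_replicate, one_pow, mul_one]
    exact hP.valuation_const (leadingCoeff_ne_zero.2 hp)
  have h3 : ∀ g ∈ IntermediateField.adjoin ℂ {x}, g ∈ P := by
    intro g hg
    obtain ⟨p, q, rfl⟩ := (IntermediateField.mem_adjoin_simple_iff ℂ g).1 hg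
    rw [← P.valuation_le_one_iff, map_div₀]
    rcases eq_or_ne p 0 with rfl | hp
    · simp
    rcases eq_or_ne q 0 with rfl | hq
    · simp
    rw [h2 p hp, h2 q hq, div_one]
  apply hT
  rw [eq_top_iff]
  intro g _
  have hint : IsIntegral (IntermediateField.adjoin ℂ {x}) Y := by
    refine ⟨X ^ 2 - C ⟨aeval x F, ?_⟩, monic_X_pow_sub_C _ two_ne_zero, ?_⟩
    · simp [M.eqn, IntermediateField.algebraMap_apply]
    · exact IntermediateField.algebra_adjoin_le_adjoin _ _
        (Polynomial.aeval_mem_adjoin_singleton ℂ x)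
  have hg : IsIntegral (IntermediateField.adjoin ℂ {x}) g := by
    have hgen : g ∈ IntermediateField.adjoin (IntermediateField.adjoin ℂ {x}) {Y} := by
      rw [← IntermediateField.mem_restrictScalars ℂ, IntermediateField.adjoin_adjoin_left,
        Set.singleton_union, M.gen]
      trivial
    have : FiniteDimensional (IntermediateField.adjoin ℂ {x})
        (IntermediateField.adjoin (IntermediateField.adjoin ℂ {x}) {Y}) :=
      IntermediateField.adjoin.finiteDimensional hint
    have := IsIntegral.of_finite (IntermediateField.adjoin ℂ {x})
      (⟨g, hgen⟩ : IntermediateField.adjoin (IntermediateField.adjoin ℂ {x}) {Y})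
    exact this.map (IntermediateField.val _)
  obtain ⟨p, hp, hpg⟩ := hg
  let i : IntermediateField.adjoin ℂ {x} →+* P :=
    (algebraMap (IntermediateField.adjoin ℂ {x}) L).codRestrict P.toSubring
      (fun u => h3 _ u.2)
  have hgP : IsIntegral P g := by
    refine ⟨p.map i, hp.map i, ?_⟩
    rw [eval₂_map]
    exact hpg
  obtain ⟨w, hw⟩ := IsIntegrallyClosed.isIntegral_iff.1 hgP
  rw [← hw]
  exact w.2

lemma exists_takesValue_Y {x₀ : ℂ} (hx : TakesValue P x x₀) :
    ∃ y₀, TakesValue P Y y₀ := by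
  have hY := M.Y_mem hP (hP.mem hx)
  obtain ⟨y, hy⟩ := IsAlgClosed.exists_pow_nat_eq (F.eval x₀) (n := 2) two_pos
  have h := hP.takesValue_aeval hx F
  rw [← M.eqn, ← hy, TakesValue, map_pow, sq_sub_sq, map_mul] at h
  by_contra hcon
  push Not at hcon
  have h1 := hcon y
  have h2 := hcon (-y)
  unfold TakesValue at h1 h2
  rw [map_neg, sub_neg_eq_add] at h2
  rw [not_lt] at h1 h2
  exact absurd h (not_lt.2 (one_le_mul h2 h1))

variable {x₀ y₀ : ℂ} (hx : TakesValue P x x₀) (hY : TakesValue P Y y₀)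
include hx hY

lemma eval_eq : y₀ ^ 2 = F.eval x₀ := by
  have h1 := hP.takesValue_pow hY 2
  rw [M.eqn] at h1
  exact hP.takesValue_unique h1 (hP.takesValue_aeval hx F)

omit M hP hx hY in
/-- An element of `ℂ[x, Y]` is its value at `(x₀, y₀)` plus an element of the ideal
`(x - x₀, Y - y₀)`. -/
lemma exists_expansion (x Y : L) (x₀ y₀ : ℂ) (r : L) (hr : r ∈ Algebra.adjoin ℂ {x, Y}) :
    ∃ k : ℂ, ∃ u ∈ Algebra.adjoin ℂ {x, Y}, ∃ w ∈ Algebra.adjoin ℂ {x, Y},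
      r = algebraMap ℂ L k + (x - algebraMap ℂ L x₀) * u + (Y - algebraMap ℂ L y₀) * w := by
  set A := Algebra.adjoin ℂ {x, Y}
  have hxA : x ∈ A := Algebra.subset_adjoin (by simp)
  have hYA : Y ∈ A := Algebra.subset_adjoin (by simp)
  induction hr using Algebra.adjoin_induction with
  | mem g hg =>
    rcases hg with rfl | hg
    · exact ⟨x₀, 1, A.one_mem, 0, A.zero_mem, by ring⟩
    · rw [Set.mem_singleton_iff] at hg
      subst hg
      exact ⟨y₀, 0, A.zero_mem, 1, A.one_mem, by ring⟩
  | algebraMap k => exact ⟨k, 0, A.zero_mem, 0, A.zero_mem, by ring⟩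
  | add g g' _ _ h h' =>
    obtain ⟨k, u, hu, w, hw, rfl⟩ := h
    obtain ⟨k', u', hu', w', hw', rfl⟩ := h'
    exact ⟨k + k', u + u', A.add_mem hu hu', w + w', A.add_mem hw hw', by rw [map_add]; ring⟩
  | mul g g' _ hg' h h' =>
    obtain ⟨k, u, hu, w, hw, rfl⟩ := h
    obtain ⟨k', u', hu', w', hw', he⟩ := h'
    refine ⟨k * k', algebraMap ℂ L k * u' + u * g',
      A.add_mem (A.mul_mem (A.algebraMap_mem k) hu') (A.mul_mem hu hg'),
      algebraMap ℂ L k * w' + w * g',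
      A.add_mem (A.mul_mem (A.algebraMap_mem k) hw') (A.mul_mem hw hg'), ?_⟩
    rw [map_mul]
    linear_combination algebraMap ℂ L k * he

omit M in
lemma mem_of_mem_adjoin (r : L) (hr : r ∈ Algebra.adjoin ℂ {x, Y}) : r ∈ P := by
  have hsub : Algebra.adjoin ℂ {x, Y} ≤
      { P.toSubring with algebraMap_mem' := hP : Subalgebra ℂ L } := by
    refine Algebra.adjoin_le ?_
    rw [Set.insert_subset_iff, Set.singleton_subset_iff]
    exact ⟨hP.mem hx, hP.mem hY⟩
  exact hsub hr

omit M in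
lemma exists_expansion_of_valuation_lt_one (r : L) (hr : r ∈ Algebra.adjoin ℂ {x, Y})
    (h : P.valuation r < 1) :
    ∃ u ∈ Algebra.adjoin ℂ {x, Y}, ∃ w ∈ Algebra.adjoin ℂ {x, Y},
      r = (x - algebraMap ℂ L x₀) * u + (Y - algebraMap ℂ L y₀) * w := by
  obtain ⟨k, u, hu, w, hw, he⟩ := exists_expansion x Y x₀ y₀ r hr
  have hk : k = 0 := by
    apply hP.eq_zero_of_valuation_lt_one
    have h1 : P.valuation ((x - algebraMap ℂ L x₀) * u) < 1 := by
      rw [map_mul]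
      exact mul_lt_one_of_lt_of_le hx
        ((P.valuation_le_one_iff _).2 (mem_of_mem_adjoin hP hx hY u hu))
    have h2 : P.valuation ((Y - algebraMap ℂ L y₀) * w) < 1 := by
      rw [map_mul]
      exact mul_lt_one_of_lt_of_le hY
        ((P.valuation_le_one_iff _).2 (mem_of_mem_adjoin hP hx hY w hw))
    have : algebraMap ℂ L k = r - (x - algebraMap ℂ L x₀) * u - (Y - algebraMap ℂ L y₀) * w := by
      rw [he]; ring
    rw [this]
    exact P.valuation.map_sub_lt (P.valuation.map_sub_lt h h1) h2
  subst hk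
  exact ⟨u, hu, w, hw, by rw [he, map_zero, zero_add]⟩

omit M hP hx hY in
lemma isNoetherianRing_adjoin (x Y : L) : IsNoetherianRing (Algebra.adjoin ℂ {x, Y}) := by
  have : Algebra.FiniteType ℂ (Algebra.adjoin ℂ {x, Y}) :=
    (Subalgebra.fg_iff_finiteType _).1 (Subalgebra.fg_def.2 ⟨{x, Y}, by simp, rfl⟩)
  exact Algebra.FiniteType.isNoetherianRing ℂ _

/-- At a point that is not a branch point of `x`, `x - x₀` is a uniformizer. -/
theorem local_of_ne (hy : y₀ ≠ 0) : IsUniformizer P (x - algebraMap ℂ L x₀) ∧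
    ∀ g ∈ P, ∃ r ∈ Algebra.adjoin ℂ {x, Y}, ∃ s ∈ Algebra.adjoin ℂ {x, Y},
      P.valuation s = 1 ∧ g = r / s := by
  have := isNoetherianRing_adjoin x Y
  have heval := M.eval_eq hP hx hY
  set A := Algebra.adjoin ℂ {x, Y}
  have hxA : x ∈ A := Algebra.subset_adjoin (by simp)
  have hYA : Y ∈ A := Algebra.subset_adjoin (by simp)
  refine isUniformizer_and_localization P A (A.sub_mem hxA (A.algebraMap_mem _))
    (M.x_sub_ne_zero x₀) hx (mem_of_mem_adjoin hP hx hY) M.exists_div ?_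
  intro r hr hlt
  obtain ⟨u, hu, w, hw, he⟩ := exists_expansion_of_valuation_lt_one hP hx hY r hr hlt
  obtain ⟨F₁, hF₁⟩ := X_sub_C_dvd_sub_C_eval (p := F) (a := x₀)
  have hF := congrArg (aeval x) hF₁
  simp only [map_sub, map_mul, aeval_X, aeval_C, ← M.eqn, ← heval] at hF
  have hF₁A : aeval x F₁ ∈ A :=
    Algebra.adjoin_mono (by simp) (Polynomial.aeval_mem_adjoin_singleton ℂ x)
  have hs : Y + algebraMap ℂ L y₀ ∈ A := A.add_mem hYA (A.algebraMap_mem _)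
  -- `(Y - y₀) (Y + y₀) = F(x) - F(x₀)` is a multiple of `x - x₀`
  refine ⟨Y + algebraMap ℂ L y₀, hs, (Y + algebraMap ℂ L y₀) * u + aeval x F₁ * w,
    A.add_mem (A.mul_mem hs hu) (A.mul_mem hF₁A hw), ?_, ?_⟩
  · refine hP.valuation_eq_one (hY.add (takesValue_const P y₀)) ?_
    rw [← two_mul]
    exact mul_ne_zero two_ne_zero hy
  · rw [he]
    rw [map_pow] at hF
    linear_combination w * hF

omit hY in
/-- At a simple root of `F`, `Y` is a uniformizer. -/
theorem local_of_eq (hF0 : F.eval x₀ = 0) (hF' : F.derivative.eval x₀ ≠ 0) :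
    IsUniformizer P Y ∧
    ∀ g ∈ P, ∃ r ∈ Algebra.adjoin ℂ {x, Y}, ∃ s ∈ Algebra.adjoin ℂ {x, Y},
      P.valuation s = 1 ∧ g = r / s := by
  obtain ⟨y₀, hY⟩ := M.exists_takesValue_Y hP hx
  have hy := M.eval_eq hP hx hY
  rw [hF0, sq_eq_zero_iff] at hy
  subst hy
  have := isNoetherianRing_adjoin x Y
  set A := Algebra.adjoin ℂ {x, Y}
  have hYA : Y ∈ A := Algebra.subset_adjoin (by simp)
  obtain ⟨F₁, hF₁⟩ := dvd_iff_isRoot.2 (show IsRoot F x₀ from hF0)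
  have hF₁x : F₁.eval x₀ ≠ 0 := by
    intro h
    apply hF'
    rw [hF₁]
    simp [h]
  have hF₁A : aeval x F₁ ∈ A :=
    Algebra.adjoin_mono (by simp) (Polynomial.aeval_mem_adjoin_singleton ℂ x)
  have hF0' : F ≠ 0 := by rintro rfl; simp at hF'
  have hY0 : Y ≠ 0 := by
    intro h
    apply M.aeval_ne_zero hF0'
    rw [← M.eqn, h, zero_pow two_ne_zero]
  have hF := congrArg (aeval x) hF₁
  simp only [map_sub, map_mul, aeval_X, aeval_C, ← M.eqn] at hF
  refine isUniformizer_and_localization P A hYA hY0 (takesValue_zero.1 hY)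
    (mem_of_mem_adjoin hP hx hY) M.exists_div ?_
  intro r hr hlt
  obtain ⟨u, hu, w, hw, he⟩ := exists_expansion_of_valuation_lt_one hP hx hY r hr hlt
  -- `(x - x₀) F₁(x) = Y²`, and `F₁(x)` is a unit
  refine ⟨aeval x F₁, hF₁A, Y * u + aeval x F₁ * w,
    A.add_mem (A.mul_mem hYA hu) (A.mul_mem hF₁A hw),
    hP.valuation_eq_one (hP.takesValue_aeval hx F₁) hF₁x, ?_⟩
  rw [he, map_zero]
  linear_combination -u * hF

lemma localization_eq (hs : F.eval x₀ ≠ 0 ∨ F.derivative.eval x₀ ≠ 0) :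
    ∀ g ∈ P, ∃ r ∈ Algebra.adjoin ℂ {x, Y}, ∃ s ∈ Algebra.adjoin ℂ {x, Y},
      P.valuation s = 1 ∧ g = r / s := by
  by_cases h : F.eval x₀ = 0
  · exact (M.local_of_eq hP hx h (hs.resolve_left (not_not.2 h))).2
  · refine (M.local_of_ne hP hx hY ?_).2
    rintro rfl
    exact h (by rw [← M.eval_eq hP hx hY]; simp)

/-- A place is determined by the values of `x` and `Y`. -/
theorem place_unique (hs : F.eval x₀ ≠ 0 ∨ F.derivative.eval x₀ ≠ 0) {Q : ValuationSubring L}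
    (hQ : ContainsConstants Q) (hx' : TakesValue Q x x₀) (hY' : TakesValue Q Y y₀) : P = Q := by
  have key : ∀ {P Q : ValuationSubring L}, ContainsConstants P → ContainsConstants Q →
      TakesValue P x x₀ → TakesValue P Y y₀ → TakesValue Q x x₀ → TakesValue Q Y y₀ → P ≤ Q := by
    intro P Q hP hQ hx hY hx' hY' g hg
    obtain ⟨r, hr, s, hs, hs1, rfl⟩ := M.localization_eq hP hx hY hs g hg
    have hrQ := mem_of_mem_adjoin hQ hx' hY' r hr
    have hsQ : Q.valuation s = 1 := by
      apply le_antisymm ((Q.valuation_le_one_iff _).2 (mem_of_mem_adjoin hQ hx' hY' s hs))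
      by_contra hlt
      obtain ⟨u, hu, w, hw, he⟩ :=
        exists_expansion_of_valuation_lt_one hQ hx' hY' s hs (not_le.1 hlt)
      have : TakesValue P s 0 := by
        rw [takesValue_zero, he]
        refine P.valuation.map_add_lt ?_ ?_
        · rw [map_mul]
          exact mul_lt_one_of_lt_of_le hx
            ((P.valuation_le_one_iff _).2 (mem_of_mem_adjoin hP hx hY u hu))
        · rw [map_mul]
          exact mul_lt_one_of_lt_of_le hY
            ((P.valuation_le_one_iff _).2 (mem_of_mem_adjoin hP hx hY w hw))
      exact (takesValue_zero.1 this).ne hs1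
    rw [← Q.valuation_le_one_iff, map_div₀, hsQ, div_one, Q.valuation_le_one_iff]
    exact hrQ
  exact le_antisymm (key hP hQ hx hY hx' hY') (key hQ hP hx' hY' hx hY)

/-- A derivation that is regular on `x` and `Y` is regular on the local ring. -/
theorem derivation_mem (hs : F.eval x₀ ≠ 0 ∨ F.derivative.eval x₀ ≠ 0) (δ : Derivation ℂ L L)
    (hδx : δ x ∈ P) (hδY : δ Y ∈ P) (g : L) (hg : g ∈ P) : δ g ∈ P := by
  have hA := mem_of_mem_adjoin hP hx hY
  have hδA : ∀ r ∈ Algebra.adjoin ℂ {x, Y}, δ r ∈ P := by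
    intro r hr
    induction hr using Algebra.adjoin_induction with
    | mem g hg =>
      rcases hg with rfl | hg
      · exact hδx
      · rw [Set.mem_singleton_iff.1 hg]; exact hδY
    | algebraMap k => rw [δ.map_algebraMap]; exact P.zero_mem
    | add g g' _ _ h h' => rw [map_add]; exact add_mem h h'
    | mul g g' hg hg' h h' =>
      rw [δ.leibniz, smul_eq_mul, smul_eq_mul]
      exact add_mem (mul_mem (hA _ hg) h') (mul_mem (hA _ hg') h)
  obtain ⟨r, hr, s, hs, hs1, rfl⟩ := M.localization_eq hP hx hY hs g hg
  have hs0 : s ≠ 0 := by rintro rfl; simp at hs1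
  have hd : δ (r / s) = (s * δ r - r * δ s) / s ^ 2 := by
    rw [Derivation.leibniz_div]
    simp only [smul_eq_mul]
    field_simp
  rw [hd, ← P.valuation_le_one_iff, map_div₀, map_pow, hs1, one_pow, div_one,
    P.valuation_le_one_iff]
  exact sub_mem (mul_mem (hA _ hs) (hδA _ hr)) (mul_mem (hA _ hr) (hδA _ hs))

end IsModel
end Model

/-! ### Existence of points, and changes of model -/

lemma valuation_inv_lt_one {L : Type} [Field L] {P : ValuationSubring L} {g : L} (hg : g ∉ P) :
    P.valuation g⁻¹ < 1 := by
  rw [← ValuationSubring.mem_nonunits_iff, ValuationSubring.inv_mem_nonunits_iff]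
  exact Or.inr hg

section Places

variable {K L : Type} [Field K] [Algebra ℂ K] [Field L] [Algebra ℂ L]

lemma takesValue_image (ψ : K →ₐ[ℂ] L) (P : ValuationSubring L) (g : K) (r : ℂ) :
    TakesValue (image ψ P) g r ↔ TakesValue P (ψ g) r := by
  unfold TakesValue
  rw [image_valuation_lt_one_iff, map_sub, AlgHom.commutes]

lemma ContainsConstants.image {P : ValuationSubring L} (hP : ContainsConstants P)
    (ψ : K →ₐ[ℂ] L) : ContainsConstants (image ψ P) := fun r => by
  rw [mem_image_iff, AlgHom.commutes]
  exact hP r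

lemma ContainsConstants.mem_points {P : ValuationSubring L} (hP : ContainsConstants P) {g : L}
    (hg : P.valuation g < 1) (hg0 : g ≠ 0) : P ∈ points L := by
  refine ⟨hP, ?_⟩
  rintro rfl
  have h := (ValuationSubring.mem_nonunits_iff (A := (⊤ : ValuationSubring L))).2 hg
  rw [ValuationSubring.mem_nonunits_iff_or] at h
  rcases h with h | h
  · exact hg0 h
  · exact h (ValuationSubring.mem_top _)

lemma exists_point_notMem {g : L} (hg : ¬ IsIntegral ℂ g) : ∃ P ∈ points L, g ∉ P := by
  have h : g ∉ (integralClosure (Subring.closure (Set.range (algebraMap ℂ L))) L).toSubring := by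
    intro hmem
    apply hg
    have hcl : Subring.closure (Set.range (algebraMap ℂ L)) = (algebraMap ℂ L).range := by
      apply le_antisymm
      · rw [Subring.closure_le]; rfl
      · exact fun _ h => Subring.subset_closure h
    rw [hcl] at hmem
    obtain ⟨p, hp, hpg⟩ := (hmem : IsIntegral (algebraMap ℂ L).range g)
    let e : ℂ ≃+* (algebraMap ℂ L).range :=
      RingEquiv.ofBijective (algebraMap ℂ L).rangeRestrict
        ⟨fun a b hab => (algebraMap ℂ L).injective (congrArg Subtype.val hab),
          (algebraMap ℂ L).rangeRestrict_surjective⟩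
    refine ⟨p.map e.symm.toRingHom, hp.map _, ?_⟩
    rw [eval₂_map]
    convert hpg using 2
    ext u
    exact congrArg Subtype.val (e.apply_symm_apply u)
  rw [← iInf_valuationSubring_superset, Subring.mem_iInf] at h
  push Not at h
  obtain ⟨⟨P, hP⟩, hgP⟩ := h
  refine ⟨P, ⟨fun r => hP ⟨r, rfl⟩, ?_⟩, hgP⟩
  rintro rfl
  exact hgP (ValuationSubring.mem_top _)

/-- A function without poles is constant. -/
lemma exists_eq_const {g : L} (hg : ∀ P ∈ points L, g ∈ P) : ∃ r : ℂ, g = algebraMap ℂ L r := by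
  have hint : IsIntegral ℂ g := by
    by_contra h
    obtain ⟨P, hP, hgP⟩ := exists_point_notMem h
    exact hgP (hg P hP)
  obtain ⟨r, hr⟩ := (IsAlgClosed.algebraMap_bijective_of_isIntegral (k := ℂ)
    (K := integralClosure ℂ L)).2 ⟨g, hint⟩
  exact ⟨r, (congrArg Subtype.val hr).symm⟩

lemma exists_point_valuation_lt_one {g : L} (hg : Transcendental ℂ g) :
    ∃ P ∈ points L, P.valuation g < 1 := by
  have h : ¬ IsIntegral ℂ g⁻¹ := by
    intro hint
    apply hg
    rw [← inv_inv g]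
    exact hint.isAlgebraic.inv
  obtain ⟨P, hP, hgP⟩ := exists_point_notMem h
  refine ⟨P, hP, ?_⟩
  simpa using valuation_inv_lt_one hgP

lemma transcendental_sub_const {g : L} (hg : Transcendental ℂ g) (r : ℂ) :
    Transcendental ℂ (g - algebraMap ℂ L r) := by
  intro h
  apply hg
  simpa using h.add (isAlgebraic_algebraMap r)

lemma exists_point_takesValue {g : L} (hg : Transcendental ℂ g) (r : ℂ) :
    ∃ P ∈ points L, TakesValue P g r :=
  exists_point_valuation_lt_one (transcendental_sub_const hg r)

lemma transcendental_inv {g : L} (hg : Transcendental ℂ g) : Transcendental ℂ g⁻¹ := by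
  intro h
  apply hg
  simpa using h.inv

lemma Transcendental.ne_zero' {g : L} (hg : Transcendental ℂ g) : g ≠ 0 := by
  rintro rfl
  exact hg isAlgebraic_zero

namespace IsModel

variable {F : ℂ[X]} {x Y : L}

lemma of_mem {F' : ℂ[X]} {x' Y' : L} (M : IsModel F x Y) (h : Y' ^ 2 = aeval x' F')
    (ht : Transcendental ℂ x') (hx : x ∈ IntermediateField.adjoin ℂ {x', Y'})
    (hY : Y ∈ IntermediateField.adjoin ℂ {x', Y'}) : IsModel F' x' Y' := by
  refine ⟨h, ?_, ht⟩
  rw [eq_top_iff, ← M.gen, IntermediateField.adjoin_le_iff, Set.insert_subset_iff,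
    Set.singleton_subset_iff]
  exact ⟨hx, hY⟩

/-- The model at infinity of a double cover. -/
lemma infinity (M : IsModel F x Y) (F' : ℂ[X]) (k : ℕ)
    (h : aeval x F = aeval x⁻¹ F' * x ^ (2 * k)) : IsModel F' x⁻¹ (Y / x ^ k) := by
  have hx0 := M.transc.ne_zero'
  have hx : x ∈ IntermediateField.adjoin ℂ {x⁻¹, Y / x ^ k} := by
    rw [← inv_inv x]
    exact inv_mem (by rw [inv_inv]; exact IntermediateField.subset_adjoin _ _ (by simp))
  refine M.of_mem ?_ (transcendental_inv M.transc) hx ?_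
  · rw [div_pow, M.eqn, h, ← pow_mul, mul_comm k, mul_div_cancel_right₀ _ (pow_ne_zero _ hx0)]
  · have hmem : Y / x ^ k ∈ IntermediateField.adjoin ℂ {x⁻¹, Y / x ^ k} :=
      IntermediateField.subset_adjoin _ _ (by simp)
    have := mul_mem hmem (pow_mem hx k)
    rwa [div_mul_cancel₀ _ (pow_ne_zero k hx0)] at this

lemma map_equiv (M : IsModel F x Y) (e : L ≃ₐ[ℂ] K) : IsModel F (e x) (e Y) := by
  refine ⟨?_, ?_, ?_⟩
  · rw [← map_pow, M.eqn, ← Polynomial.aeval_algHom_apply]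
  · have h := congrArg (IntermediateField.map (e : L →ₐ[ℂ] K)) M.gen
    rw [IntermediateField.adjoin_map, Set.image_pair] at h
    refine h.trans ?_
    rw [← AlgHom.fieldRange_eq_map]
    exact AlgEquiv.fieldRange_eq_top e
  · exact fun h => M.transc ((isAlgebraic_algHom_iff (e : L →ₐ[ℂ] K) e.injective).1 h)

end IsModel

lemma ratFunc_transcendental : Transcendental ℂ (RatFunc.X : RatFunc ℂ) := by
  rintro ⟨p, hp, h⟩
  apply hp
  rw [RatFunc.aeval_X_left_eq_algebraMap] at h
  simpa using h

/-- The rational function field, as a model with `Y = 1`. -/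
lemma ratFunc_model : IsModel 1 (RatFunc.X : RatFunc ℂ) 1 := by
  refine ⟨by simp, ?_, ratFunc_transcendental⟩
  rw [eq_top_iff, ← RatFunc.adjoin_X]
  exact IntermediateField.adjoin.mono _ _ _ (by simp)

lemma ratFunc_model_infinity : IsModel 1 (RatFunc.X : RatFunc ℂ)⁻¹ 1 := by
  simpa using ratFunc_model.infinity 1 0 (by simp)

end Places

/-! ### The function field of `Y² = F(x)` -/

section Curve

/-- The coordinate `x` on the curve `Y² = F(x)`. -/
def curveX (F : ℂ[X]) : CurveField F := proj F RatFunc.X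

lemma proj_algebraMap (F p : ℂ[X]) : proj F (algebraMap ℂ[X] (RatFunc ℂ) p) =
    aeval (curveX F) p := by
  rw [curveX, Polynomial.aeval_algHom_apply, RatFunc.aeval_X_left_eq_algebraMap]

lemma exists_curveY (F : ℂ[X]) : ∃ y : CurveField F, y ^ 2 = aeval (curveX F) F := by
  have hs := SplittingField.splits (X ^ 2 - C (algebraMap ℂ[X] (RatFunc ℂ) F))
  have hd : ((X ^ 2 - C (algebraMap ℂ[X] (RatFunc ℂ) F)).map
      (algebraMap (RatFunc ℂ) (CurveField F))).degree ≠ 0 := by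
    rw [degree_map, degree_X_pow_sub_C two_pos]
    decide
  obtain ⟨y, hy⟩ := hs.exists_eval_eq_zero hd
  refine ⟨y, ?_⟩
  rw [eval_map, eval₂_sub, eval₂_pow, eval₂_X, eval₂_C, sub_eq_zero] at hy
  rw [hy, ← proj_algebraMap]
  rfl

/-- The coordinate `Y` on the curve `Y² = F(x)`. -/
def curveY (F : ℂ[X]) : CurveField F := (exists_curveY F).choose

lemma curveY_sq (F : ℂ[X]) : curveY F ^ 2 = aeval (curveX F) F := (exists_curveY F).choose_spec

lemma curveX_transcendental (F : ℂ[X]) : Transcendental ℂ (curveX F) := fun h =>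
  ratFunc_transcendental ((isAlgebraic_algHom_iff (proj F) (proj F).injective).1 h)

lemma proj_mem (F : ℂ[X]) (E : IntermediateField ℂ (CurveField F)) (hx : curveX F ∈ E)
    (g : RatFunc ℂ) : proj F g ∈ E := by
  have : (⊤ : IntermediateField ℂ (RatFunc ℂ)) ≤ E.comap (proj F) := by
    rw [← RatFunc.adjoin_X, IntermediateField.adjoin_le_iff, Set.singleton_subset_iff]
    exact hx
  exact this (IntermediateField.mem_top (x := g))

lemma root_eq_or (F : ℂ[X]) {y : CurveField F}
    (hy : y ∈ (X ^ 2 - C (algebraMap ℂ[X] (RatFunc ℂ) F)).rootSet (CurveField F)) :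
    y = curveY F ∨ y = -curveY F := by
  have h := (mem_rootSet.1 hy).2
  rw [map_sub, map_pow, aeval_X, aeval_C, sub_eq_zero] at h
  apply sq_eq_sq_iff_eq_or_eq_neg.1
  rw [h, curveY_sq, ← proj_algebraMap]
  rfl

/-- The function field of `Y² = F(x)` is generated by the coordinates. -/
lemma curve_model (F : ℂ[X]) : IsModel F (curveX F) (curveY F) := by
  refine ⟨curveY_sq F, ?_, curveX_transcendental F⟩
  set E := IntermediateField.adjoin ℂ {curveX F, curveY F}
  have hx : curveX F ∈ E := IntermediateField.subset_adjoin _ _ (by simp)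
  have hY : curveY F ∈ E := IntermediateField.subset_adjoin _ _ (by simp)
  rw [eq_top_iff]
  intro g _
  have hg : g ∈ (⊤ : Subalgebra (RatFunc ℂ) (CurveField F)) := Algebra.mem_top
  rw [← SplittingField.adjoin_rootSet] at hg
  induction hg using Algebra.adjoin_induction with
  | mem y hy =>
    rcases root_eq_or F hy with rfl | rfl
    · exact hY
    · exact neg_mem hY
  | algebraMap r => exact proj_mem F E hx r
  | add _ _ _ _ h h' => exact add_mem (h trivial) (h' trivial)
  | mul _ _ _ _ h h' => exact mul_mem (h trivial) (h' trivial)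

end Curve

/-! ### Coverings: construction and degree -/

section Degree

variable {K L M : Type} [Field K] [Algebra ℂ K] [Field L] [Algebra ℂ L] [Field M] [Algebra ℂ M]

lemma coverDegree_eq_finrank (ψ : K →ₐ[ℂ] L) :
    coverDegree ψ = @Module.finrank K L _ _ ψ.toRingHom.toAlgebra.toModule := by
  let _ := ψ.toRingHom.toAlgebra
  symm
  refine Algebra.finrank_eq_of_equiv_equiv (AlgEquiv.ofInjectiveField ψ).toRingEquiv
    (RingEquiv.refl L) ?_
  ext k
  rfl

/-- The degree of coverings is multiplicative. -/
theorem coverDegree_comp (ψ : L →ₐ[ℂ] M) (β : K →ₐ[ℂ] L) :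
    coverDegree (ψ.comp β) = coverDegree β * coverDegree ψ := by
  rw [coverDegree_eq_finrank, coverDegree_eq_finrank, coverDegree_eq_finrank]
  let _ := ψ.toRingHom.toAlgebra
  let _ := β.toRingHom.toAlgebra
  let _ := (ψ.comp β).toRingHom.toAlgebra
  have : IsScalarTower K L M := IsScalarTower.of_algebraMap_eq (fun _ => rfl)
  exact (Module.finrank_mul_finrank K L M).symm

lemma bijective_of_coverDegree_eq_one {ψ : K →ₐ[ℂ] L} (h : coverDegree ψ = 1) :
    Function.Bijective ψ := by
  refine ⟨ψ.injective, fun g => ?_⟩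
  have hsurj := (finrank_eq_one_iff_of_nonzero' (K := ψ.fieldRange) (1 : L) one_ne_zero).1 h g
  obtain ⟨⟨_, u, rfl⟩, hu⟩ := hsurj
  exact ⟨u, by rw [← hu, Algebra.smul_def, mul_one]; rfl⟩

lemma exists_ratFunc_hom {g : L} (hg : Transcendental ℂ g) :
    ∃ σ : RatFunc ℂ →ₐ[ℂ] L, σ RatFunc.X = g := by
  have hinj : Function.Injective (aeval g : ℂ[X] →ₐ[ℂ] L) := transcendental_iff_injective.1 hg
  refine ⟨RatFunc.liftAlgHom (aeval g)
    (nonZeroDivisors_le_comap_nonZeroDivisors_of_injective (aeval g : ℂ[X] →ₐ[ℂ] L) hinj), ?_⟩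
  rw [← RatFunc.algebraMap_X]
  simp [RatFunc.liftAlgHom_apply]

/-- A map of the line extends to the curve `Y² = F(x)` as soon as `F` becomes a square. -/
lemma exists_curve_hom (F : ℂ[X]) (σ : RatFunc ℂ →ₐ[ℂ] L) (y : L)
    (hy : y ^ 2 = aeval (σ RatFunc.X) F) :
    ∃ ψ : CurveField F →ₐ[ℂ] L, ψ.comp (proj F) = σ ∧
      (ψ (curveY F) = y ∨ ψ (curveY F) = -y) := by
  let _ := σ.toRingHom.toAlgebra
  have hmap : σ (algebraMap ℂ[X] (RatFunc ℂ) F) = y ^ 2 := by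
    rw [hy, Polynomial.aeval_algHom_apply, RatFunc.aeval_X_left_eq_algebraMap]
  have hs : ((X ^ 2 - C (algebraMap ℂ[X] (RatFunc ℂ) F)).map (algebraMap (RatFunc ℂ) L)).Splits := by
    have : (X ^ 2 - C (algebraMap ℂ[X] (RatFunc ℂ) F)).map (algebraMap (RatFunc ℂ) L) =
        (X - C y) * (X + C y) := by
      have h : algebraMap (RatFunc ℂ) L (algebraMap ℂ[X] (RatFunc ℂ) F) = y ^ 2 := hmap
      rw [Polynomial.map_sub, Polynomial.map_pow, map_X, map_C, h, map_pow]
      ring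
    rw [this]
    exact (Splits.X_sub_C y).mul (Splits.X_add_C y)
  let τ : CurveField F →ₐ[RatFunc ℂ] L := SplittingField.lift _ hs
  let ψ : CurveField F →ₐ[ℂ] L :=
    { τ.toRingHom with
      commutes' := fun r => by
        have h1 : algebraMap ℂ (CurveField F) r =
          algebraMap (RatFunc ℂ) (CurveField F) (algebraMap ℂ (RatFunc ℂ) r) :=
            (IsScalarTower.algebraMap_apply _ _ _ r)
        rw [h1]
        exact (τ.commutes _).trans (σ.commutes r) }
  have hψ : ψ.comp (proj F) = σ := AlgHom.ext fun r => τ.commutes r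
  refine ⟨ψ, hψ, ?_⟩
  apply sq_eq_sq_iff_eq_or_eq_neg.1
  rw [← map_pow, curveY_sq, hy, ← Polynomial.aeval_algHom_apply, ← hψ]
  rfl

lemma not_isSquare_of_squarefree {F : ℂ[X]} (hF : Squarefree F) (hu : ¬ IsUnit F)
    (b : RatFunc ℂ) : b ^ 2 ≠ algebraMap ℂ[X] (RatFunc ℂ) F := by
  intro h
  have hint : IsIntegral ℂ[X] b := by
    refine ⟨X ^ 2 - C F, monic_X_pow_sub_C _ two_ne_zero, ?_⟩
    simp [h]
  obtain ⟨q, rfl⟩ := IsIntegrallyClosed.isIntegral_iff.1 hint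
  rw [← map_pow] at h
  have hq := IsFractionRing.injective ℂ[X] (RatFunc ℂ) h
  have hqu := hF q ⟨1, by rw [mul_one, ← sq, hq]⟩
  exact hu (by rw [← hq]; exact hqu.pow 2)

lemma curveY_irreducible_aeval {F : ℂ[X]} (hF : Squarefree F) (hu : ¬ IsUnit F) :
    Irreducible (X ^ 2 - C (algebraMap ℂ[X] (RatFunc ℂ) F)) ∧
      aeval (curveY F) (X ^ 2 - C (algebraMap ℂ[X] (RatFunc ℂ) F)) = 0 := by
  refine ⟨X_pow_sub_C_irreducible_of_prime Nat.prime_two (not_isSquare_of_squarefree hF hu), ?_⟩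
  rw [map_sub, map_pow, aeval_X, aeval_C, curveY_sq, ← proj_algebraMap, sub_eq_zero]
  rfl

/-- The projection from `Y² = F(x)` to the line has degree `2`. -/
theorem coverDegree_proj {F : ℂ[X]} (hF : Squarefree F) (hu : ¬ IsUnit F) :
    coverDegree (proj F) = 2 := by
  have h1 : coverDegree (proj F) = Module.finrank (RatFunc ℂ) (CurveField F) := by
    rw [coverDegree_eq_finrank]
    congr 1
    refine Module.ext' _ _ fun r g => ?_
    rw [Algebra.smul_def]
    rfl
  rw [h1]
  obtain ⟨hirr, hroot⟩ := curveY_irreducible_aeval hF hu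
  have hint : IsIntegral (RatFunc ℂ) (curveY F) := ⟨_, monic_X_pow_sub_C _ two_ne_zero, hroot⟩
  have htop : IntermediateField.adjoin (RatFunc ℂ) {curveY F} = ⊤ := by
    rw [eq_top_iff]
    intro g _
    have hg : g ∈ (⊤ : Subalgebra (RatFunc ℂ) (CurveField F)) := Algebra.mem_top
    rw [← SplittingField.adjoin_rootSet] at hg
    have hY := IntermediateField.mem_adjoin_simple_self (RatFunc ℂ) (curveY F)
    have hle : Algebra.adjoin (RatFunc ℂ)
        ((X ^ 2 - C (algebraMap ℂ[X] (RatFunc ℂ) F)).rootSet (CurveField F)) ≤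
        (IntermediateField.adjoin (RatFunc ℂ) {curveY F}).toSubalgebra := by
      refine Algebra.adjoin_le fun y hy => ?_
      rcases root_eq_or F hy with rfl | rfl
      · exact hY
      · exact neg_mem hY
    exact hle hg
  rw [← IntermediateField.finrank_top', ← htop, IntermediateField.adjoin.finrank hint,
    ← minpoly.eq_of_irreducible_of_monic hirr hroot (monic_X_pow_sub_C _ two_ne_zero),
    natDegree_X_pow_sub_C]

/-- The degree of a map of the line is the degree of the rational function defining it. -/
theorem coverDegree_ratFunc (φ : RatFunc ℂ →ₐ[ℂ] RatFunc ℂ) :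
    coverDegree φ = max (φ RatFunc.X).num.natDegree (φ RatFunc.X).denom.natDegree := by
  rw [← RatFunc.finrank_eq_max_natDegree]
  have h : φ.fieldRange = IntermediateField.adjoin ℂ {φ RatFunc.X} := by
    rw [AlgHom.fieldRange_eq_map, ← RatFunc.adjoin_X, IntermediateField.adjoin_map,
      Set.image_singleton]
  unfold coverDegree
  rw [h]

/-- The degree of the map of the line given by a reduced fraction. -/
lemma coverDegree_of_isCoprime (φ : RatFunc ℂ →ₐ[ℂ] RatFunc ℂ) {N D : ℂ[X]}
    (hND : IsCoprime N D) (hD : D ≠ 0)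
    (hφ : φ RatFunc.X = algebraMap ℂ[X] (RatFunc ℂ) N / algebraMap ℂ[X] (RatFunc ℂ) D) :
    coverDegree φ = max N.natDegree D.natDegree := by
  have hnum := RatFunc.num_div_denom (φ RatFunc.X)
  have hcop := RatFunc.isCoprime_num_denom (φ RatFunc.X)
  have hd := RatFunc.denom_ne_zero (φ RatFunc.X)
  rw [coverDegree_ratFunc]
  set n := (φ RatFunc.X).num
  set d := (φ RatFunc.X).denom
  have hD' : algebraMap ℂ[X] (RatFunc ℂ) D ≠ 0 := by simpa using hD
  have hd' : algebraMap ℂ[X] (RatFunc ℂ) d ≠ 0 := by simpa using hd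
  rw [hφ, div_eq_div_iff hd' hD', ← map_mul, ← map_mul] at hnum
  have he : n * D = N * d := IsFractionRing.injective ℂ[X] (RatFunc ℂ) hnum
  have h1 : Associated n N := associated_of_dvd_dvd
    (hcop.dvd_of_dvd_mul_right ⟨D, he.symm⟩)
    (hND.dvd_of_dvd_mul_right ⟨d, he⟩)
  have h2 : Associated d D := associated_of_dvd_dvd
    (hcop.symm.dvd_of_dvd_mul_left ⟨N, by rw [he, mul_comm]⟩)
    (hND.symm.dvd_of_dvd_mul_left ⟨n, by rw [← he, mul_comm]⟩)
  rw [natDegree_eq_of_degree_eq (degree_eq_degree_of_associated h1),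
    natDegree_eq_of_degree_eq (degree_eq_degree_of_associated h2)]

end Degree

/-! ### Function fields of elliptic curves -/

section Elliptic

variable (W : WeierstrassCurve ℂ)

/-- The coordinate `x` in the function field of a Weierstrass curve. -/
def ellX : W.toAffine.FunctionField :=
  algebraMap W.toAffine.CoordinateRing _ (AdjoinRoot.of _ X)

/-- The coordinate `y` in the function field of a Weierstrass curve. -/
def ellY : W.toAffine.FunctionField :=
  algebraMap W.toAffine.CoordinateRing _ (AdjoinRoot.root _)

/-- The function `2y + a₁x + a₃`, whose square is a cubic in `x`. -/
def ellZ : W.toAffine.FunctionField :=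
  2 * ellY W + algebraMap ℂ _ W.a₁ * ellX W + algebraMap ℂ _ W.a₃

/-- The cubic `4x³ + b₂x² + 2b₄x + b₆`, the square of `2y + a₁x + a₃`. -/
def ellCubic : ℂ[X] := C 4 * X ^ 3 + C W.b₂ * X ^ 2 + C (2 * W.b₄) * X + C W.b₆

lemma algebraMap_of (p : ℂ[X]) : algebraMap W.toAffine.CoordinateRing W.toAffine.FunctionField
    (AdjoinRoot.of _ p) = aeval (ellX W) p := by
  have : ∀ p : ℂ[X], (AdjoinRoot.of W.toAffine.polynomial p) =
    aeval (AdjoinRoot.of W.toAffine.polynomial X) p := by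
    intro p
    induction p using Polynomial.induction_on' with
    | add p q hp hq => rw [map_add, map_add, hp, hq]
    | monomial n c =>
      rw [aeval_monomial, ← C_mul_X_pow_eq_monomial, map_mul, map_pow]
      rfl
  rw [this, ellX, Polynomial.aeval_algebraMap_apply]

lemma ell_equation : ellY W ^ 2 + algebraMap ℂ _ W.a₁ * ellX W * ellY W +
    algebraMap ℂ _ W.a₃ * ellY W = ellX W ^ 3 + algebraMap ℂ _ W.a₂ * ellX W ^ 2 +
    algebraMap ℂ _ W.a₄ * ellX W + algebraMap ℂ _ W.a₆ := by
  have h : (algebraMap W.toAffine.CoordinateRing W.toAffine.FunctionField)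
      (AdjoinRoot.mk W.toAffine.polynomial (X ^ 2 + C (C W.a₁ * X + C W.a₃) * X -
        C (X ^ 3 + C W.a₂ * X ^ 2 + C W.a₄ * X + C W.a₆))) = 0 := by
    rw [show (X ^ 2 + C (C W.a₁ * X + C W.a₃) * X -
        C (X ^ 3 + C W.a₂ * X ^ 2 + C W.a₄ * X + C W.a₆) : ℂ[X][X]) = W.toAffine.polynomial
        from rfl, AdjoinRoot.mk_self, map_zero]
  simp only [map_add, map_sub, map_mul, map_pow, AdjoinRoot.mk_C, AdjoinRoot.mk_X] at h
  simp only [← map_pow, ← map_mul, ← map_add, algebraMap_of] at h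
  simp only [map_pow, map_mul, map_add, aeval_X, aeval_C] at h
  rw [← sub_eq_zero, ← h, ellY]
  ring

lemma algebraMap_mem_adjoin (r : W.toAffine.CoordinateRing) :
    algebraMap _ W.toAffine.FunctionField r ∈ IntermediateField.adjoin ℂ {ellX W, ellY W} := by
  have hx : ∀ p : ℂ[X], aeval (ellX W) p ∈ IntermediateField.adjoin ℂ {ellX W, ellY W} := fun p =>
    IntermediateField.algebra_adjoin_le_adjoin _ _
      (Algebra.adjoin_mono (by simp) (Polynomial.aeval_mem_adjoin_singleton ℂ (ellX W)))
  obtain ⟨p, q, rfl⟩ := WeierstrassCurve.Affine.CoordinateRing.exists_smul_basis_eq r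
  rw [Algebra.smul_def, Algebra.smul_def, mul_one, map_add, map_mul]
  refine add_mem ?_ (mul_mem ?_ (IntermediateField.subset_adjoin _ _ (Or.inr rfl)))
  · exact algebraMap_of W p ▸ hx p
  · exact algebraMap_of W q ▸ hx q

lemma ell_adjoin : IntermediateField.adjoin ℂ {ellX W, ellY W} = ⊤ := by
  rw [eq_top_iff]
  intro g _
  obtain ⟨r, s, -, rfl⟩ := IsFractionRing.div_surjective (A := W.toAffine.CoordinateRing) g
  exact div_mem (algebraMap_mem_adjoin W r) (algebraMap_mem_adjoin W s)

lemma ellX_transcendental : Transcendental ℂ (ellX W) := by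
  rintro ⟨p, hp, h⟩
  rw [← algebraMap_of] at h
  apply hp
  apply FaithfulSMul.algebraMap_injective ℂ[X] W.toAffine.CoordinateRing
  rw [map_zero]
  apply IsFractionRing.injective W.toAffine.CoordinateRing W.toAffine.FunctionField
  rw [map_zero]
  exact h

lemma ellZ_sq : ellZ W ^ 2 = aeval (ellX W) (ellCubic W) := by
  have h := ell_equation W
  simp only [ellCubic, ellZ, map_add, map_mul, map_pow, aeval_X, aeval_C,
    WeierstrassCurve.b₂, WeierstrassCurve.b₄, WeierstrassCurve.b₆, map_ofNat]
  linear_combination 4 * h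

lemma ell_model : IsModel (ellCubic W) (ellX W) (ellZ W) := by
  refine ⟨ellZ_sq W, ?_, ellX_transcendental W⟩
  rw [eq_top_iff, ← ell_adjoin, IntermediateField.adjoin_le_iff, Set.insert_subset_iff,
    Set.singleton_subset_iff]
  set E := IntermediateField.adjoin ℂ {ellX W, ellZ W}
  have hx : ellX W ∈ E := IntermediateField.subset_adjoin _ _ (by simp)
  have hz : ellZ W ∈ E := IntermediateField.subset_adjoin _ _ (by simp)
  refine ⟨hx, ?_⟩
  have h2 : (2 : W.toAffine.FunctionField) ∈ E := ofNat_mem E 2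
  have : ellY W = (ellZ W - algebraMap ℂ _ W.a₁ * ellX W - algebraMap ℂ _ W.a₃) / 2 := by
    have : CharZero W.toAffine.FunctionField :=
      charZero_of_injective_algebraMap (algebraMap ℂ W.toAffine.FunctionField).injective
    rw [eq_div_iff two_ne_zero, ellZ]
    ring
  rw [this]
  exact div_mem (sub_mem (sub_mem hz (mul_mem (E.algebraMap_mem _) hx)) (E.algebraMap_mem _)) h2

/-- At infinity the square root of the cubic becomes the square root of the reversed quartic. -/
lemma ell_model_infinity : IsModel (C 4 * X + C W.b₂ * X ^ 2 + C (2 * W.b₄) * X ^ 3 +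
    C W.b₆ * X ^ 4) (ellX W)⁻¹ (ellZ W / ellX W ^ 2) := by
  refine (ell_model W).infinity _ 2 ?_
  have hx := (ellX_transcendental W).ne_zero'
  simp only [ellCubic, map_add, map_mul, map_pow, aeval_X, aeval_C]
  field_simp
  ring

/-- The cubic has no double root, because the discriminant does not vanish. -/
lemma ellCubic_smooth (hW : W.Δ ≠ 0) (x₀ : ℂ) :
    (ellCubic W).eval x₀ ≠ 0 ∨ (ellCubic W).derivative.eval x₀ ≠ 0 := by
  by_contra! h
  obtain ⟨h1, h2⟩ := h
  apply hW
  simp [ellCubic] at h1 h2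
  have hb := W.b_relation
  rw [WeierstrassCurve.Δ]
  -- one step of the Euclidean algorithm on the cubic and half its derivative
  have h3 : (24 * W.b₄ - W.b₂ ^ 2) * x₀ + (18 * W.b₆ - W.b₂ * W.b₄) = 0 := by
    linear_combination 18 * h1 - (12 * x₀ + W.b₂) / 2 * h2
  linear_combination (-1 / 72) * ((24 * W.b₄ - W.b₂ ^ 2) ^ 2 / 2 * h2 -
    (6 * ((24 * W.b₄ - W.b₂ ^ 2) * x₀ - (18 * W.b₆ - W.b₂ * W.b₄)) +
      W.b₂ * (24 * W.b₄ - W.b₂ ^ 2)) * h3) - W.b₂ ^ 2 / 4 * hb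

/-- The invariant differential of a Weierstrass curve is `dx / (2y + a₁x + a₃)`; this is the dual
derivation. It is read off from the homomorphism to the dual numbers lifting the identity. -/
lemma exists_derivation : ∃ δ : Derivation ℂ W.toAffine.FunctionField W.toAffine.FunctionField,
    δ (ellX W) = ellZ W := by
  let x' : DualNumber W.toAffine.FunctionField :=
    TrivSqZeroExt.inl (ellX W) + TrivSqZeroExt.inr (ellZ W)
  -- the derivative of `y` forced by the equation
  let η : W.toAffine.FunctionField :=
    3 * ellX W ^ 2 + 2 * algebraMap ℂ _ W.a₂ * ellX W + algebraMap ℂ _ W.a₄ -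
    algebraMap ℂ _ W.a₁ * ellY W
  let y' : DualNumber W.toAffine.FunctionField :=
    TrivSqZeroExt.inl (ellY W) + TrivSqZeroExt.inr η
  have heval : W.toAffine.polynomial.eval₂
      (aeval x' : ℂ[X] →ₐ[ℂ] DualNumber W.toAffine.FunctionField).toRingHom y' =
      0 := by
    change eval₂ _ _ (X ^ 2 + C (C W.a₁ * X + C W.a₃) * X -
      C (X ^ 3 + C W.a₂ * X ^ 2 + C W.a₄ * X + C W.a₆)) = 0
    simp only [eval₂_add, eval₂_sub, eval₂_mul, eval₂_pow, eval₂_X, eval₂_C,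
      AlgHom.toRingHom_eq_coe, RingHom.coe_coe, map_add, map_mul, map_pow, aeval_X, aeval_C]
    have h := ell_equation W
    have halg : ∀ r : ℂ, algebraMap ℂ (DualNumber W.toAffine.FunctionField) r =
        TrivSqZeroExt.inl (algebraMap ℂ W.toAffine.FunctionField r) := fun _ => rfl
    ext
    · simp [x', y', pow_succ, halg]
      linear_combination h
    · simp [x', y', pow_succ, η, ellZ, halg]
      ring
  let Ψ : W.toAffine.CoordinateRing →ₐ[ℂ] DualNumber W.toAffine.FunctionField :=
    AdjoinRoot.liftAlgHom _ (aeval x') y' heval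
  have hΨ : ∀ r, (Ψ r).fst = algebraMap W.toAffine.CoordinateRing W.toAffine.FunctionField r := by
    intro r
    have h : ((TrivSqZeroExt.fstHom ℂ W.toAffine.FunctionField W.toAffine.FunctionField).comp Ψ) =
        IsScalarTower.toAlgHom ℂ W.toAffine.CoordinateRing W.toAffine.FunctionField := by
      apply AdjoinRoot.algHom_ext'
      · apply Polynomial.algHom_ext
        simp [Ψ, x', ellX, AdjoinRoot.ofAlgHom]
      · simp [Ψ, y', ellY]
    exact DFunLike.congr_fun h r
  have hu : ∀ r : nonZeroDivisors W.toAffine.CoordinateRing, IsUnit (Ψ r) := by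
    intro r
    rw [TrivSqZeroExt.isUnit_iff_isUnit_fst, hΨ, isUnit_iff_ne_zero]
    exact IsFractionRing.to_map_ne_zero_of_mem_nonZeroDivisors r.2
  let Φ : W.toAffine.FunctionField →ₐ[ℂ] DualNumber W.toAffine.FunctionField :=
    IsLocalization.liftAlgHom hu
  have hΦ : ∀ r : W.toAffine.CoordinateRing, Φ (algebraMap _ W.toAffine.FunctionField r) = Ψ r := fun r =>
    IsLocalization.lift_eq hu r
  have hfst : ∀ g, (Φ g).fst = g := by
    intro g
    have h : ((TrivSqZeroExt.fstHom ℂ W.toAffine.FunctionField W.toAffine.FunctionField).comp Φ).toRingHom =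
        RingHom.id W.toAffine.FunctionField := by
      apply IsLocalization.ringHom_ext (nonZeroDivisors W.toAffine.CoordinateRing)
      refine RingHom.ext fun r => ?_
      exact (congrArg TrivSqZeroExt.fst (hΦ r)).trans (hΨ r)
    exact DFunLike.congr_fun h g
  refine ⟨Derivation.mk' ((TrivSqZeroExt.sndHom W.toAffine.FunctionField
    W.toAffine.FunctionField).restrictScalars ℂ ∘ₗ Φ.toLinearMap) ?_, ?_⟩
  · intro g g'
    simp [TrivSqZeroExt.snd_mul, hfst]
    exact mul_comm _ _
  · have : Φ (ellX W) = x' := by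
      rw [ellX, hΦ]
      exact (AdjoinRoot.liftAlgHom_of ..).trans (aeval_X x')
    simp [this, x']

end Elliptic

/-! ### Regular derivations and maximality -/

section Regular

variable {L : Type} [Field L] [Algebra ℂ L]

/-- A derivation of a function field is regular if it preserves every local ring of the curve. -/
def IsRegularDerivation (δ : Derivation ℂ L L) : Prop :=
  ∀ P ∈ points L, ∀ g ∈ P, δ g ∈ P

namespace IsModel

variable {F : ℂ[X]} {x Y : L} (M : IsModel F x Y)
include M

lemma Y_ne_zero (hF : F ≠ 0) : Y ≠ 0 := by
  intro h
  apply M.aeval_ne_zero hF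
  rw [← M.eqn, h, zero_pow two_ne_zero]

lemma derivation_Y (hF : F ≠ 0) (δ : Derivation ℂ L L) (u : L) (hx : δ x = Y * u) :
    δ Y = algebraMap ℂ L (1 / 2) * (aeval x F.derivative * u) := by
  have h := congrArg δ M.eqn
  rw [Derivation.map_aeval, hx, Derivation.leibniz_pow] at h
  simp only [smul_eq_mul, nsmul_eq_mul, Nat.cast_ofNat, Nat.add_one_sub_one, pow_one] at h
  have h2 : algebraMap ℂ L (1 / 2) * 2 = 1 := by
    rw [← map_ofNat (algebraMap ℂ L) 2, ← map_mul]
    norm_num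
  apply mul_left_cancel₀ (M.Y_ne_zero hF)
  linear_combination algebraMap ℂ L (1 / 2) * h - Y * δ Y * h2

lemma derivation_eq_zero (δ : Derivation ℂ L L) (hx : δ x = 0) (hY : δ Y = 0) : δ = 0 := by
  have hA : ∀ r ∈ Algebra.adjoin ℂ {x, Y}, δ r = 0 := by
    intro r hr
    induction hr using Algebra.adjoin_induction with
    | mem g hg =>
      rcases hg with rfl | hg
      · exact hx
      · rw [Set.mem_singleton_iff.1 hg]; exact hY
    | algebraMap k => exact δ.map_algebraMap k
    | add g g' _ _ h h' => rw [map_add, h, h', add_zero]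
    | mul g g' _ _ h h' => rw [δ.leibniz, h, h', smul_zero, smul_zero, add_zero]
  ext g
  obtain ⟨r, hr, s, hs, rfl⟩ := M.exists_div g
  simp [Derivation.leibniz_div, hA r hr, hA s hs]

/-- On a double cover of the line branched over at least six points, there is no regular derivation:
for a regular derivation `δ`, the function `δ(x) / Y` has no poles, and it vanishes over
`x = ∞`. -/
theorem regularDerivation_eq_zero
    (hF : ∀ r, F.eval r ≠ 0 ∨ F.derivative.eval r ≠ 0)
    {F' : ℂ[X]} (M' : IsModel F' x⁻¹ (Y / x ^ 3)) (hF' : F'.eval 0 ≠ 0)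
    {δ : Derivation ℂ L L} (hδ : IsRegularDerivation δ) : δ = 0 := by
  have hF0 : F ≠ 0 := by rintro rfl; simpa using hF 0
  have hY := M.Y_ne_zero hF0
  have hx0 := M.transc.ne_zero'
  set f := δ x / Y with hf
  have hδx : δ x = Y * f := by rw [hf]; field_simp
  have hδY := M.derivation_Y hF0 δ f hδx
  have hinf : ∀ P ∈ points L, P.valuation x⁻¹ < 1 → P.valuation f < 1 := by
    intro P hP hlt
    have hPc : ContainsConstants P := hP.1
    have ht : TakesValue P x⁻¹ 0 := takesValue_zero.2 hlt
    obtain ⟨y₀, hy⟩ := M'.exists_takesValue_Y hPc ht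
    have hy0 := M'.eval_eq hPc ht hy
    have hy1 : y₀ ≠ 0 := by
      rintro rfl
      apply hF'
      rw [← hy0]
      simp
    have hδt := hδ P hP _ (hPc.mem ht)
    have he : f = -(δ x⁻¹ * x⁻¹ / (Y / x ^ 3)) := by
      rw [Derivation.leibniz_inv, hδx]
      simp only [smul_eq_mul]
      field_simp
    rw [he, Valuation.map_neg, map_div₀, hPc.valuation_eq_one hy hy1, div_one, mul_comm, map_mul]
    exact mul_lt_one_of_lt_of_le hlt ((P.valuation_le_one_iff _).2 hδt)
  have hreg : ∀ P ∈ points L, f ∈ P := by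
    intro P hP
    have hPc : ContainsConstants P := hP.1
    by_cases hx : x ∈ P
    · obtain ⟨x₀, hx₀⟩ := M.exists_takesValue_x hPc hP.2 hx
      obtain ⟨y₀, hy₀⟩ := M.exists_takesValue_Y hPc hx₀
      have hev := M.eval_eq hPc hx₀ hy₀
      rw [← P.valuation_le_one_iff]
      by_cases h0 : y₀ = 0
      · have hF1 : F.derivative.eval x₀ ≠ 0 := by
          refine (hF x₀).resolve_left ?_
          rw [← hev, h0]
          simp
        have h1 := (P.valuation_le_one_iff _).2 (hδ P hP Y (hPc.mem hy₀))
        rwa [hδY, map_mul, map_mul, hPc.valuation_const (by norm_num), one_mul,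
          hPc.valuation_eq_one (hPc.takesValue_aeval hx₀ _) hF1, one_mul] at h1
      · rw [hf, map_div₀, hPc.valuation_eq_one hy₀ h0, div_one, P.valuation_le_one_iff]
        exact hδ P hP x hx
    · exact (P.valuation_le_one_iff _).1 (hinf P hP (valuation_inv_lt_one hx)).le
  obtain ⟨r, hr⟩ := exists_eq_const hreg
  obtain ⟨P, hP, hlt⟩ := exists_point_valuation_lt_one (transcendental_inv M.transc)
  have hlt' := hinf P hP hlt
  rw [hr] at hlt'
  have hr0 := ContainsConstants.eq_zero_of_valuation_lt_one hP.1 hlt'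
  rw [hr0, map_zero] at hr
  refine M.derivation_eq_zero δ ?_ ?_
  · rw [hδx, hr, mul_zero]
  · rw [hδY, hr, mul_zero, mul_zero]

end IsModel

/-- The derivation dual to the invariant differential of an elliptic curve is regular. -/
theorem exists_regularDerivation (W : WeierstrassCurve ℂ) (hW : W.Δ ≠ 0) :
    ∃ δ : Derivation ℂ W.toAffine.FunctionField W.toAffine.FunctionField,
      IsRegularDerivation δ ∧ δ ≠ 0 := by
  obtain ⟨δ, hδ⟩ := exists_derivation W
  have M := ell_model W
  have M' := ell_model_infinity W
  have hsm := ellCubic_smooth W hW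
  have hC0 : ellCubic W ≠ 0 := by
    intro h
    simpa [h] using hsm 0
  have hx0 := M.transc.ne_zero'
  refine ⟨δ, ?_, ?_⟩
  · intro P hP
    have hPc : ContainsConstants P := hP.1
    by_cases hx : ellX W ∈ P
    · obtain ⟨x₀, hx₀⟩ := M.exists_takesValue_x hPc hP.2 hx
      obtain ⟨y₀, hy₀⟩ := M.exists_takesValue_Y hPc hx₀
      refine M.derivation_mem hPc hx₀ hy₀ (hsm x₀) δ (hδ ▸ hPc.mem hy₀) ?_
      rw [M.derivation_Y hC0 δ 1 (by rw [hδ, mul_one]), mul_one]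
      exact mul_mem (hPc _) (hPc.mem (hPc.takesValue_aeval hx₀ _))
    · have ht : TakesValue P (ellX W)⁻¹ 0 := takesValue_zero.2 (valuation_inv_lt_one hx)
      obtain ⟨y₀, hy₀⟩ := M'.exists_takesValue_Y hPc ht
      have hsm' : (C 4 * X + C W.b₂ * X ^ 2 + C (2 * W.b₄) * X ^ 3 +
          C W.b₆ * X ^ 4).derivative.eval 0 ≠ 0 := by
        simp
      have hδt : δ (ellX W)⁻¹ = ellZ W / ellX W ^ 2 * (-1) := by
        rw [Derivation.leibniz_inv, hδ]
        simp only [smul_eq_mul]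
        field_simp
      refine M'.derivation_mem hPc ht hy₀ (Or.inr hsm') δ ?_ ?_
      · rw [hδt]
        exact mul_mem (hPc.mem hy₀) (neg_mem (one_mem P))
      · rw [M'.derivation_Y (by rintro h; rw [h] at hsm'; simp at hsm') δ _ hδt]
        exact mul_mem (hPc _) (mul_mem (hPc.mem (hPc.takesValue_aeval ht _))
          (neg_mem (one_mem P)))
  · rintro rfl
    exact M.Y_ne_zero hC0 hδ.symm

/-- A covering of prime degree of an elliptic curve by a curve without regular derivations is
maximal: the intermediate elliptic curve cannot be the covering curve. -/
theorem isMaximalCover_of_prime {K : Type} [Field K] [Algebra ℂ K] {ψ : K →ₐ[ℂ] L}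
    (hp : (coverDegree ψ).Prime) {F F' : ℂ[X]} {x Y : L} (M : IsModel F x Y)
    (hF : ∀ r, F.eval r ≠ 0 ∨ F.derivative.eval r ≠ 0)
    (M' : IsModel F' x⁻¹ (Y / x ^ 3)) (hF' : F'.eval 0 ≠ 0) : IsMaximalCover ψ := by
  intro W hW β ψ' h
  rw [h, coverDegree_comp, Nat.prime_mul_iff] at hp
  rcases hp with ⟨-, h1⟩ | ⟨-, h1⟩
  · exfalso
    let e := (AlgEquiv.ofBijective ψ' (bijective_of_coverDegree_eq_one h1)).symm
    obtain ⟨δ, hδ, hδ0⟩ := exists_regularDerivation W hW.isUnit.ne_zero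
    have M₁' : IsModel F' (e x)⁻¹ (e Y / e x ^ 3) := by
      have := M'.map_equiv e
      rwa [map_inv₀, map_div₀, map_pow] at this
    exact hδ0 ((M.map_equiv e).regularDerivation_eq_zero hF M₁' hF' hδ)
  · exact bijective_of_coverDegree_eq_one h1

end Regular

/-! ### Squarefree polynomials and the quartic -/

lemma eval_or_derivative_ne_zero {F : ℂ[X]} (hF : Squarefree F) (r : ℂ) :
    F.eval r ≠ 0 ∨ F.derivative.eval r ≠ 0 := by
  by_contra! h
  obtain ⟨u, w, he⟩ := PerfectField.separable_iff_squarefree.2 hF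
  have := congrArg (eval r) he
  simp [h.1, h.2] at this

lemma eval_ne_zero_of_squarefree_mul {A B : ℂ[X]} (h : Squarefree (A * B)) {r : ℂ}
    (hA : A.eval r = 0) : B.eval r ≠ 0 := by
  intro hB
  have hd : (X - C r) * (X - C r) ∣ A * B :=
    mul_dvd_mul (dvd_iff_isRoot.2 hA) (dvd_iff_isRoot.2 hB)
  exact not_isUnit_X_sub_C r (h _ hd)

lemma squarefree_quartic {t s : ℂ} (ht0 : t ≠ 0) (ht1 : t ≠ 1) (hs0 : s ≠ 0) (hs1 : s ≠ 1)
    (hst : s ≠ t) : Squarefree (quartic t s) := by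
  have hinj : Function.Injective ![0, 1, t, s] := by
    intro i j
    fin_cases i <;> fin_cases j <;> simp [ht0, ht1, hs0, hs1, hst, ht0.symm, ht1.symm, hs0.symm,
      hs1.symm, hst.symm]
  have h := (separable_prod_X_sub_C_iff (F := ℂ)).2 hinj
  have he : quartic t s = ∏ i, (X - C (![0, 1, t, s] i)) := by
    rw [quartic, Fin.prod_univ_four]
    simp
  rw [he]
  exact h.squarefree

/-- The curve `y² = z(z-1)(z-t)(z-s)` is elliptic: the substitution `U = -ts/z`, `V = ts y/z²`
moves its Weierstrass point `z = 0` to infinity, and gives `V² = (U+ts)(U+s)(U+t)`. -/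
theorem isElliptic_quartic {t s : ℂ} (ht0 : t ≠ 0) (ht1 : t ≠ 1) (hs0 : s ≠ 0) (hs1 : s ≠ 1)
    (hst : s ≠ t) : IsEllipticFunctionField (CurveField (quartic t s)) := by
  let W : WeierstrassCurve ℂ :=
    ⟨0, t * s + s + t, 0, t * s * s + t * s * t + s * t, (t * s) ^ 2⟩
  have hΔ : W.Δ = 16 * (s * (t - 1)) ^ 2 * (t * (s - 1)) ^ 2 * (s - t) ^ 2 := by
    simp only [W, WeierstrassCurve.Δ, WeierstrassCurve.b₂, WeierstrassCurve.b₄,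
      WeierstrassCurve.b₆, WeierstrassCurve.b₈]
    ring
  refine ⟨W, ⟨?_⟩, ?_⟩
  · rw [hΔ, isUnit_iff_ne_zero]
    have h1 := sub_ne_zero.2 ht1
    have h2 := sub_ne_zero.2 hs1
    have h3 := sub_ne_zero.2 hst
    exact mul_ne_zero (mul_ne_zero (mul_ne_zero (by norm_num) (pow_ne_zero 2 (mul_ne_zero hs0 h1)))
      (pow_ne_zero 2 (mul_ne_zero ht0 h2))) (pow_ne_zero 2 h3)
  have hX := ellX_transcendental W
  have hX0 := hX.ne_zero'
  set k : W.toAffine.FunctionField := algebraMap ℂ _ (t * s) with hk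
  have hk0 : k ≠ 0 := by
    rw [hk, ne_eq, map_eq_zero]
    exact mul_ne_zero ht0 hs0
  have hz : Transcendental ℂ (-k / ellX W) := by
    intro h
    apply hX
    have h2 := ((isAlgebraic_algebraMap (A := W.toAffine.FunctionField) (t * s)).neg).mul h.inv
    rw [← hk] at h2
    rwa [div_eq_mul_inv, mul_inv, inv_inv, ← mul_assoc, mul_inv_cancel₀ (neg_ne_zero.2 hk0),
      one_mul] at h2
  obtain ⟨σ, hσ⟩ := exists_ratFunc_hom hz
  have heq := ell_equation W
  have hy : (k * ellY W / ellX W ^ 2) ^ 2 = aeval (σ RatFunc.X) (quartic t s) := by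
    simp only [hσ, quartic, map_mul, map_sub, aeval_X, aeval_C, map_one]
    rw [hk, map_mul]
    simp only [show W.a₁ = 0 from rfl, show W.a₂ = t * s + s + t from rfl,
      show W.a₃ = 0 from rfl, show W.a₄ = t * s * s + t * s * t + s * t from rfl,
      show W.a₆ = (t * s) ^ 2 from rfl, map_zero, zero_mul, add_zero, map_add, map_mul,
      map_pow] at heq
    rw [div_pow, mul_pow, heq]
    field_simp
    ring
  obtain ⟨ψ, hψ, hψY⟩ := exists_curve_hom (quartic t s) σ _ hy
  have hψX : ψ (curveX (quartic t s)) = -k / ellX W := by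
    rw [← hσ, ← hψ]
    rfl
  refine ⟨AlgEquiv.ofBijective ψ ⟨ψ.injective, ?_⟩⟩
  rw [← AlgHom.fieldRange_eq_top, eq_top_iff, ← ell_adjoin, IntermediateField.adjoin_le_iff,
    Set.insert_subset_iff, Set.singleton_subset_iff]
  have hkm : k ∈ ψ.fieldRange := ψ.fieldRange.algebraMap_mem _
  have hXm : ellX W ∈ ψ.fieldRange := by
    have h1 : -k / ψ (curveX (quartic t s)) ∈ ψ.fieldRange := div_mem (neg_mem hkm) ⟨_, rfl⟩
    convert h1 using 1
    rw [hψX]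
    field_simp
  refine ⟨hXm, ?_⟩
  have hYm : k * ellY W / ellX W ^ 2 ∈ ψ.fieldRange := by
    rcases hψY with h | h
    · exact ⟨_, h⟩
    · rw [← neg_neg (k * ellY W / ellX W ^ 2), ← h]
      exact neg_mem ⟨_, rfl⟩
  have h1 := div_mem (mul_mem hYm (pow_mem hXm 2)) hkm
  have h2 : k * ellY W / ellX W ^ 2 * ellX W ^ 2 / k = ellY W := by field_simp
  rwa [h2] at h1

/-! ### The cubic map of the line -/

/-- The numerator of the Frey-Kani covering. -/
def mapNum (a : ℂ) : ℂ[X] := X * (C 2 * X - C a) ^ 2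

/-- The denominator of the Frey-Kani covering. -/
def mapDen (a : ℂ) : ℂ[X] := C ((a - 1) ^ 2) - C (2 * a - 3) * X

/-- The polynomial whose roots are the finite ramification points of the Frey-Kani covering. -/
def mapRam (a : ℂ) : ℂ[X] :=
  C 2 * (C 2 * X - C a) * (C 2 * X - C (a - 1)) * (C 2 * X - C (a * (a - 1) / (2 * a - 3)))

lemma ram_eq_zero_iff (a x : ℂ) : (mapRam a).eval x = 0 ↔
    x = a / 2 ∨ x = (a - 1) / 2 ∨ x = a * (a - 1) / (2 * a - 3) / 2 := by
  simp only [mapRam, eval_mul, eval_sub, eval_C, eval_X, mul_eq_zero, OfNat.ofNat_ne_zero,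
    false_or, sub_eq_zero, or_assoc, eq_div_iff (two_ne_zero' ℂ), mul_comm x]

lemma map_half (a : ℂ) : (mapNum a).eval (a / 2) / (mapDen a).eval (a / 2) = 0 := by
  simp [mapNum]
  left; right
  ring

/-- The conditions on the parameters: `t` and `s` are the given functions of `a` and `c`, and no two
of the points `0`, `1`, `t`, `s` or of the roots of the sextic collide (`admissible`). -/
structure Admissible (a c t s : ℂ) : Prop where
  a_one : a - 1 ≠ 0
  two_a : 2 * a - 3 ≠ 0
  a_zero : a ≠ 0
  a_two : a - 2 ≠ 0
  a_three : a - 3 ≠ 0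
  t_eq : t = a ^ 3 * (a - 2) / (2 * a - 3) ^ 3
  s_eq : s = 4 * c / (a - 1) ^ 2
  s_zero : s ≠ 0
  s_one : s ≠ 1
  s_t : s ≠ t

lemma admissible {a c t s : ℂ} (ha₁ : a - 1 ≠ 0) (ha₂ : 2 * a - 3 ≠ 0)
    (hC : Squarefree (sextic a c))
    (ht : t = a ^ 3 * (a - 2) / (2 * a - 3) ^ 3) (hs : s = 4 * c / (a - 1) ^ 2) :
    Admissible a c t s := by
  have e1 := eval_ne_zero_of_squarefree_mul (r := 0) (A := X) (B := (X - 1) *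
    (X - C (a * (a - 2) / (2 * a - 3))) *
    (X ^ 3 - C a * X ^ 2 + C ((2 * a - 3) * c / (a - 1) ^ 2 + a ^ 2 / 4) * X - C c))
    (by convert hC using 1; rw [sextic]; ring) (by simp)
  have e2 := eval_ne_zero_of_squarefree_mul (r := 1) (A := X - 1) (B := X *
    (X - C (a * (a - 2) / (2 * a - 3))) *
    (X ^ 3 - C a * X ^ 2 + C ((2 * a - 3) * c / (a - 1) ^ 2 + a ^ 2 / 4) * X - C c))
    (by convert hC using 1; rw [sextic]; ring) (by simp)
  have e3 := eval_ne_zero_of_squarefree_mul (r := a * (a - 2) / (2 * a - 3))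
    (A := X - C (a * (a - 2) / (2 * a - 3))) (B :=
    X ^ 3 - C a * X ^ 2 + C ((2 * a - 3) * c / (a - 1) ^ 2 + a ^ 2 / 4) * X - C c)
    (by
      refine hC.squarefree_of_dvd ⟨X * (X - 1), ?_⟩
      rw [sextic]; ring) (by simp)
  simp at e1 e2 e3
  obtain ⟨⟨⟨h0, h2⟩, -⟩, h3⟩ := e1
  have ha₂' : a * 2 - 3 ≠ 0 := by rwa [mul_comm]
  obtain ⟨h4, h5⟩ := e2
  have ha3 : a - 3 ≠ 0 := by
    intro h
    apply h4
    field_simp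
    linear_combination -(a - 1) * h
  refine ⟨ha₁, ha₂, h0, h2, ha3, ht, hs, ?_, ?_, ?_⟩
  · rw [hs]; simp [h3, ha₁]
  · intro h
    apply h5
    rw [hs, div_eq_one_iff_eq (pow_ne_zero 2 ha₁)] at h
    have hc : c = (a - 1) ^ 2 / 4 := by linear_combination h / 4
    rw [hc]
    field_simp
    ring
  · intro h
    apply e3
    rw [hs, ht, div_eq_iff (pow_ne_zero 2 ha₁)] at h
    have hc : c = a ^ 3 * (a - 2) / (2 * a - 3) ^ 3 * (a - 1) ^ 2 / 4 := by
      linear_combination h / 4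
    rw [hc]
    field_simp
    ring

namespace Admissible

variable {a c t s : ℂ} (A : Admissible a c t s)
include A

lemma t_zero : t ≠ 0 := by
  rw [A.t_eq]
  exact div_ne_zero (mul_ne_zero (pow_ne_zero 3 A.a_zero) A.a_two) (pow_ne_zero 3 A.two_a)

lemma t_one : t ≠ 1 := by
  rw [A.t_eq, ne_eq, div_eq_one_iff_eq (pow_ne_zero 3 A.two_a), ← sub_eq_zero]
  have : a ^ 3 * (a - 2) - (2 * a - 3) ^ 3 = (a - 1) * (a - 3) ^ 3 := by ring
  rw [this]
  exact mul_ne_zero A.a_one (pow_ne_zero 3 A.a_three)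

lemma cubic_eq (x : ℂ) : x * (2 * x - a) ^ 2 - s * ((a - 1) ^ 2 - (2 * a - 3) * x) =
    4 * (x ^ 3 - a * x ^ 2 + ((2 * a - 3) * c / (a - 1) ^ 2 + a ^ 2 / 4) * x - c) := by
  have h1 := A.a_one
  rw [A.s_eq]
  field_simp
  ring

/-- The pullback of the quartic under the cubic map is the sextic up to a square. -/
lemma identity : mapNum a * (mapNum a - mapDen a) * (mapNum a - C t * mapDen a) *
    (mapNum a - C s * mapDen a) = sextic a c * mapRam a ^ 2 := by
  have h1 := A.a_one
  have h2 := A.two_a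
  have h2' : a * 2 - 3 ≠ 0 := by rwa [mul_comm]
  apply Polynomial.funext
  intro x
  simp only [mapNum, mapDen, mapRam, sextic, eval_mul, eval_sub, eval_add, eval_pow, eval_X,
    eval_C, eval_one]
  have i1 : x * (2 * x - a) ^ 2 - ((a - 1) ^ 2 - (2 * a - 3) * x) =
    (x - 1) * (2 * x - (a - 1)) ^ 2 := by ring
  have i2 : x * (2 * x - a) ^ 2 - t * ((a - 1) ^ 2 - (2 * a - 3) * x) =
      (x - a * (a - 2) / (2 * a - 3)) * (2 * x - a * (a - 1) / (2 * a - 3)) ^ 2 := by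
    rw [A.t_eq]
    field_simp
    ring
  rw [i1, i2, A.cubic_eq]
  ring

lemma wronskian (x : ℂ) : (mapNum a).derivative.eval x * (mapDen a).eval x -
    (mapNum a).eval x * (mapDen a).derivative.eval x =
    -(2 * a - 3) / 2 * (mapRam a).eval x := by
  have h2 := A.two_a
  have h2' : a * 2 - 3 ≠ 0 := by rwa [mul_comm]
  simp only [mapNum, mapDen, mapRam, eval_mul, eval_sub, eval_add, eval_pow, eval_X, eval_C,
    derivative_mul, derivative_sub, derivative_pow, derivative_X, derivative_C, eval_zero, eval_one]
  field_simp
  ring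

lemma num_ne_zero {x : ℂ} (h : (mapDen a).eval x = 0) : (mapNum a).eval x ≠ 0 := by
  have h2 := A.two_a
  have h2' : a * 2 - 3 ≠ 0 := by rwa [mul_comm]
  simp only [mapNum, mapDen, eval_mul, eval_sub, eval_pow, eval_X, eval_C] at h ⊢
  have hx : x = (a - 1) ^ 2 / (2 * a - 3) := by
    rw [eq_div_iff h2]
    linear_combination -h
  rw [hx]
  refine mul_ne_zero (div_ne_zero (pow_ne_zero 2 A.a_one) h2) (pow_ne_zero 2 ?_)
  have : 2 * ((a - 1) ^ 2 / (2 * a - 3)) - a = -(a - 2) / (2 * a - 3) := by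
    field_simp
    ring
  rw [this]
  exact div_ne_zero (neg_ne_zero.2 A.a_two) h2

lemma den_half : (mapDen a).eval (a / 2) ≠ 0 := by
  intro h
  apply A.num_ne_zero h
  simp [mapNum]
  right
  ring

lemma den_half' : (mapDen a).eval ((a - 1) / 2) ≠ 0 := by
  have : (mapDen a).eval ((a - 1) / 2) = (a - 1) / 2 := by
    simp [mapDen]
    ring
  rw [this]
  exact div_ne_zero A.a_one two_ne_zero

lemma map_half' : (mapNum a).eval ((a - 1) / 2) / (mapDen a).eval ((a - 1) / 2) = 1 := by
  rw [div_eq_one_iff_eq A.den_half']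
  simp [mapNum, mapDen]
  ring

lemma den_third : (mapDen a).eval (a * (a - 1) / (2 * a - 3) / 2) ≠ 0 := by
  have h2 := A.two_a
  have h2' : a * 2 - 3 ≠ 0 := by rwa [mul_comm]
  have : (mapDen a).eval (a * (a - 1) / (2 * a - 3) / 2) = (a - 1) * (a - 2) / 2 := by
    simp [mapDen]
    field_simp
    ring
  rw [this]
  exact div_ne_zero (mul_ne_zero A.a_one A.a_two) two_ne_zero

lemma map_third : (mapNum a).eval (a * (a - 1) / (2 * a - 3) / 2) /
    (mapDen a).eval (a * (a - 1) / (2 * a - 3) / 2) = t := by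
  have h2 := A.two_a
  have h2' : a * 2 - 3 ≠ 0 := by rwa [mul_comm]
  rw [div_eq_iff A.den_third, A.t_eq]
  simp [mapNum, mapDen]
  field_simp
  ring

lemma ram_derivative_ne_zero {x : ℂ} (h : (mapRam a).eval x = 0) :
    (mapRam a).derivative.eval x ≠ 0 := by
  have h2 := A.two_a
  have h2' : a * 2 - 3 ≠ 0 := by rwa [mul_comm]
  have h1 := A.a_one
  have h3 := A.a_three
  have h0 := A.a_zero
  have key : ∀ x, (mapRam a).derivative.eval x = 4 * ((2 * x - (a - 1)) *
      (2 * x - a * (a - 1) / (2 * a - 3)) + (2 * x - a) * (2 * x - a * (a - 1) / (2 * a - 3)) +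
      (2 * x - a) * (2 * x - (a - 1))) := by
    intro x
    simp only [mapRam, eval_mul, eval_sub, eval_add, eval_X, eval_C,
      derivative_mul, derivative_sub, derivative_X, derivative_C, eval_zero, eval_one]
    ring
  rw [key]
  refine mul_ne_zero (by norm_num) ?_
  rcases (ram_eq_zero_iff a x).1 h with rfl | rfl | rfl
  · have : (2 * (a / 2) - (a - 1)) * (2 * (a / 2) - a * (a - 1) / (2 * a - 3)) +
        (2 * (a / 2) - a) * (2 * (a / 2) - a * (a - 1) / (2 * a - 3)) +
        (2 * (a / 2) - a) * (2 * (a / 2) - (a - 1)) = a * (a - 2) / (2 * a - 3) := by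
      field_simp
      ring
    rw [this]
    exact div_ne_zero (mul_ne_zero h0 A.a_two) h2
  · have : (2 * ((a - 1) / 2) - (a - 1)) * (2 * ((a - 1) / 2) - a * (a - 1) / (2 * a - 3)) +
        (2 * ((a - 1) / 2) - a) * (2 * ((a - 1) / 2) - a * (a - 1) / (2 * a - 3)) +
        (2 * ((a - 1) / 2) - a) * (2 * ((a - 1) / 2) - (a - 1)) =
        -((a - 1) * (a - 3)) / (2 * a - 3) := by
      field_simp
      ring
    rw [this]
    exact div_ne_zero (neg_ne_zero.2 (mul_ne_zero h1 h3)) h2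
  · set w := a * (a - 1) / (2 * a - 3) with hw
    have : (2 * (w / 2) - (a - 1)) * (2 * (w / 2) - w) + (2 * (w / 2) - a) * (2 * (w / 2) - w) +
        (2 * (w / 2) - a) * (2 * (w / 2) - (a - 1)) =
        a * (a - 1) * ((a - 2) * (a - 3)) / (2 * a - 3) ^ 2 := by
      rw [hw]
      field_simp
      ring
    rw [this]
    exact div_ne_zero (mul_ne_zero (mul_ne_zero h0 h1) (mul_ne_zero A.a_two h3))
      (pow_ne_zero 2 h2)

/-- The ramification points of the cubic map are not branch points of the sextic curve. -/
lemma sextic_ne_zero_of_ram {x : ℂ} (h : (mapRam a).eval x = 0) : (sextic a c).eval x ≠ 0 := by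
  have h2 := A.two_a
  have h2' : a * 2 - 3 ≠ 0 := by rwa [mul_comm]
  have h1 := A.a_one
  have h3 := A.a_three
  have h0 := A.a_zero
  have h4 := A.a_two
  have hcub : ∀ {x z : ℂ}, (mapDen a).eval x ≠ 0 →
      (mapNum a).eval x / (mapDen a).eval x = z → s ≠ z →
      x ^ 3 - a * x ^ 2 + ((2 * a - 3) * c / (a - 1) ^ 2 + a ^ 2 / 4) * x - c ≠ 0 := by
    intro x z hD hz hs h
    have hc := A.cubic_eq x
    rw [h, mul_zero] at hc
    apply hs
    rw [← hz, eq_div_iff hD]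
    simp only [mapNum, mapDen, eval_mul, eval_sub, eval_pow, eval_X, eval_C]
    linear_combination -hc
  have hev : ∀ x : ℂ, (sextic a c).eval x = x * (x - 1) * (x - a * (a - 2) / (2 * a - 3)) *
      (x ^ 3 - a * x ^ 2 + ((2 * a - 3) * c / (a - 1) ^ 2 + a ^ 2 / 4) * x - c) := by
    intro x
    simp [sextic]
  rw [hev]
  rcases (ram_eq_zero_iff a x).1 h with rfl | rfl | rfl
  · refine mul_ne_zero (mul_ne_zero (mul_ne_zero (div_ne_zero h0 two_ne_zero) ?_) ?_)
      (hcub A.den_half (map_half a) A.s_zero)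
    · rw [show a / 2 - 1 = (a - 2) / 2 by ring]
      exact div_ne_zero h4 two_ne_zero
    · rw [show a / 2 - a * (a - 2) / (2 * a - 3) = a / (2 * (2 * a - 3)) by field_simp; ring]
      exact div_ne_zero h0 (mul_ne_zero two_ne_zero h2)
  · refine mul_ne_zero (mul_ne_zero (mul_ne_zero (div_ne_zero h1 two_ne_zero) ?_) ?_)
      (hcub A.den_half' A.map_half' A.s_one)
    · rw [show (a - 1) / 2 - 1 = (a - 3) / 2 by ring]
      exact div_ne_zero h3 two_ne_zero
    · rw [show (a - 1) / 2 - a * (a - 2) / (2 * a - 3) = -(a - 3) / (2 * (2 * a - 3)) by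
        field_simp; ring]
      exact div_ne_zero (neg_ne_zero.2 h3) (mul_ne_zero two_ne_zero h2)
  · refine mul_ne_zero (mul_ne_zero (mul_ne_zero
      (div_ne_zero (div_ne_zero (mul_ne_zero h0 h1) h2) two_ne_zero) ?_) ?_)
      (hcub A.den_third A.map_third A.s_t)
    · rw [show a * (a - 1) / (2 * a - 3) / 2 - 1 = (a - 2) * (a - 3) / (2 * (2 * a - 3)) by
        field_simp; ring]
      exact div_ne_zero (mul_ne_zero h4 h3) (mul_ne_zero two_ne_zero h2)
    · rw [show a * (a - 1) / (2 * a - 3) / 2 - a * (a - 2) / (2 * a - 3) =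
        -(a * (a - 3)) / (2 * (2 * a - 3)) by field_simp; ring]
      exact div_ne_zero (neg_ne_zero.2 (mul_ne_zero h0 h3)) (mul_ne_zero two_ne_zero h2)

end Admissible

/-! ### Ramification of the cubic map -/

section Valuation

variable {L : Type} [Field L] [Algebra ℂ L] {P : ValuationSubring L} {x : L}

lemma valuation_of_simple_root (hP : ContainsConstants P) {x₀ : ℂ} (hx : TakesValue P x x₀)
    {p : ℂ[X]} (h0 : p.eval x₀ = 0) (h1 : p.derivative.eval x₀ ≠ 0) :
    P.valuation (aeval x p) = P.valuation (x - algebraMap ℂ L x₀) := by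
  obtain ⟨q, rfl⟩ := dvd_iff_isRoot.2 (show IsRoot p x₀ from h0)
  have hq : q.eval x₀ ≠ 0 := by
    intro h
    apply h1
    simp [h]
  rw [map_mul, map_mul, hP.valuation_eq_one (hP.takesValue_aeval hx q) hq, mul_one]
  simp

lemma valuation_of_double_root (hP : ContainsConstants P) {x₀ : ℂ} (hx : TakesValue P x x₀)
    {p : ℂ[X]} (h0 : p.eval x₀ = 0) (h1 : p.derivative.eval x₀ = 0)
    (h2 : p.derivative.derivative.eval x₀ ≠ 0) :
    P.valuation (aeval x p) = P.valuation (x - algebraMap ℂ L x₀) ^ 2 := by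
  obtain ⟨q, rfl⟩ := dvd_iff_isRoot.2 (show IsRoot p x₀ from h0)
  have hq : q.eval x₀ = 0 := by simpa using h1
  have hq' : q.derivative.eval x₀ ≠ 0 := by
    intro h
    apply h2
    simp [h]
  rw [map_mul, map_mul, valuation_of_simple_root hP hx hq hq', sq]
  simp

variable {a c t s : ℂ}

lemma takesValue_map (hP : ContainsConstants P) {x₀ : ℂ} (hx : TakesValue P x x₀)
    (hD : (mapDen a).eval x₀ ≠ 0) : TakesValue P (aeval x (mapNum a) / aeval x (mapDen a))
      ((mapNum a).eval x₀ / (mapDen a).eval x₀) :=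
  hP.takesValue_div (hP.takesValue_aeval hx _) (hP.takesValue_aeval hx _) hD

namespace Admissible

variable (A : Admissible a c t s)
include A

lemma den_ne_zero (hx : Transcendental ℂ x) : aeval x (mapDen a) ≠ 0 := by
  intro h
  refine hx ⟨_, ?_, h⟩
  intro h0
  have := congrArg (eval 0) h0
  simp only [mapDen, eval_sub, eval_mul, eval_C, eval_X, mul_zero, sub_zero, eval_zero] at this
  exact pow_ne_zero 2 A.a_one this

lemma num_ne_zero' (hx : Transcendental ℂ x) : aeval x (mapNum a) ≠ 0 := by
  intro h
  refine hx ⟨_, ?_, h⟩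
  intro h0
  have := congrArg (eval (a / 2 + 1)) h0
  simp only [mapNum, eval_sub, eval_mul, eval_C, eval_X, eval_pow, eval_zero] at this
  rw [show 2 * (a / 2 + 1) - a = 2 by ring] at this
  have h2 : a / 2 + 1 = 0 := by simpa using this
  have := congrArg (eval 1) h0
  simp only [mapNum, eval_sub, eval_mul, eval_C, eval_X, eval_pow, eval_zero] at this
  have h3 : 2 * 1 - a = 0 := by simpa using this
  exact A.a_two (by linear_combination -h3)

/-- The value of the cubic map, minus its value at an unramified point, has a simple zero. -/
lemma valuation_map_of_unramified (hP : ContainsConstants P) {x₀ : ℂ} (hx : TakesValue P x x₀)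
    (hxt : Transcendental ℂ x) (hD : (mapDen a).eval x₀ ≠ 0) (hR : (mapRam a).eval x₀ ≠ 0) :
    P.valuation (aeval x (mapNum a) / aeval x (mapDen a) -
      algebraMap ℂ L ((mapNum a).eval x₀ / (mapDen a).eval x₀)) =
      P.valuation (x - algebraMap ℂ L x₀) := by
  set z₀ := (mapNum a).eval x₀ / (mapDen a).eval x₀ with hz₀
  have hden := A.den_ne_zero hxt
  have he : aeval x (mapNum a) / aeval x (mapDen a) - algebraMap ℂ L z₀ =
      aeval x (mapNum a - C z₀ * mapDen a) / aeval x (mapDen a) := by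
    rw [map_sub, map_mul, aeval_C]
    field_simp
  rw [he, map_div₀, hP.valuation_eq_one (hP.takesValue_aeval hx _) hD, div_one]
  apply valuation_of_simple_root hP hx
  · simp [hz₀, div_mul_cancel₀ _ hD]
  · intro h
    have hw := A.wronskian x₀
    have h1 : (mapNum a).derivative.eval x₀ - z₀ * (mapDen a).derivative.eval x₀ = 0 := by
      simpa using h
    have h2 : z₀ * (mapDen a).eval x₀ = (mapNum a).eval x₀ := div_mul_cancel₀ _ hD
    have h3 : -(2 * a - 3) / 2 * (mapRam a).eval x₀ = 0 := by
      rw [← hw]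
      linear_combination (mapDen a).eval x₀ * h1 + (mapDen a).derivative.eval x₀ * h2
    exact mul_ne_zero (div_ne_zero (neg_ne_zero.2 A.two_a) two_ne_zero) hR h3

/-- The value of the cubic map, minus its value at a ramification point, has a double zero. -/
lemma valuation_map_of_ramified (hP : ContainsConstants P) {x₀ : ℂ} (hx : TakesValue P x x₀)
    (hxt : Transcendental ℂ x) (hD : (mapDen a).eval x₀ ≠ 0) (hR : (mapRam a).eval x₀ = 0) :
    P.valuation (aeval x (mapNum a) / aeval x (mapDen a) -
      algebraMap ℂ L ((mapNum a).eval x₀ / (mapDen a).eval x₀)) =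
      P.valuation (x - algebraMap ℂ L x₀) ^ 2 := by
  set z₀ := (mapNum a).eval x₀ / (mapDen a).eval x₀ with hz₀
  have hden := A.den_ne_zero hxt
  have he : aeval x (mapNum a) / aeval x (mapDen a) - algebraMap ℂ L z₀ =
      aeval x (mapNum a - C z₀ * mapDen a) / aeval x (mapDen a) := by
    rw [map_sub, map_mul, aeval_C]
    field_simp
  have h2 : z₀ * (mapDen a).eval x₀ = (mapNum a).eval x₀ := div_mul_cancel₀ _ hD
  have hw := A.wronskian x₀
  rw [hR, mul_zero] at hw
  have h1 : (mapNum a).derivative.eval x₀ - z₀ * (mapDen a).derivative.eval x₀ = 0 := by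
    apply mul_left_cancel₀ hD
    linear_combination hw - (mapDen a).derivative.eval x₀ * h2
  rw [he, map_div₀, hP.valuation_eq_one (hP.takesValue_aeval hx _) hD, div_one]
  apply valuation_of_double_root hP hx
  · simp [hz₀, div_mul_cancel₀ _ hD]
  · simpa using h1
  · intro h
    -- the derivative of the Wronskian vanishes together with the second derivative
    have hpoly : (mapNum a).derivative * mapDen a - mapNum a * (mapDen a).derivative =
        C (-(2 * a - 3) / 2) * mapRam a := by
      apply Polynomial.funext
      intro y
      simpa using A.wronskian y
    have hd := congrArg (fun p : ℂ[X] => p.derivative.eval x₀) hpoly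
    simp only [derivative_sub, derivative_mul, derivative_C, eval_sub, eval_add, eval_mul, eval_C,
      zero_mul, zero_add] at hd
    have h3 : (mapNum a).derivative.derivative.eval x₀ -
        z₀ * (mapDen a).derivative.derivative.eval x₀ = 0 := by
      simpa using h
    have h4 : -(2 * a - 3) / 2 * (mapRam a).derivative.eval x₀ = 0 := by
      rw [← hd]
      linear_combination (mapDen a).eval x₀ * h3 +
        (mapDen a).derivative.derivative.eval x₀ * h2
    exact mul_ne_zero (div_ne_zero (neg_ne_zero.2 A.two_a) two_ne_zero)
      (A.ram_derivative_ne_zero hR) h4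

/-- The finite pole of the cubic map is simple. -/
lemma valuation_inv_map_of_pole (hP : ContainsConstants P) {x₀ : ℂ} (hx : TakesValue P x x₀)
    (hD : (mapDen a).eval x₀ = 0) :
    P.valuation (aeval x (mapNum a) / aeval x (mapDen a))⁻¹ =
      P.valuation (x - algebraMap ℂ L x₀) := by
  rw [inv_div, map_div₀, hP.valuation_eq_one (hP.takesValue_aeval hx _) (A.num_ne_zero hD), div_one]
  apply valuation_of_simple_root hP hx hD
  have : (mapDen a).derivative.eval x₀ = -(2 * a - 3) := by
    simp only [mapDen, derivative_sub, derivative_mul, derivative_C, derivative_X, eval_sub,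
      eval_add, eval_mul, eval_C, eval_zero, eval_one]
    ring
  rw [this]
  exact neg_ne_zero.2 A.two_a

/-- The pole of the cubic map at infinity is double. -/
lemma valuation_inv_map_infinity (hP : ContainsConstants P) (hx : P.valuation x⁻¹ < 1)
    (hxt : Transcendental ℂ x) :
    P.valuation (aeval x (mapNum a) / aeval x (mapDen a))⁻¹ = P.valuation x⁻¹ ^ 2 := by
  have hx0 := hxt.ne_zero'
  have ht := takesValue_zero.2 hx
  have he : (aeval x (mapNum a) / aeval x (mapDen a))⁻¹ = (x⁻¹) ^ 2 *
      (aeval x⁻¹ (C ((a - 1) ^ 2) * X - C (2 * a - 3)) / aeval x⁻¹ ((C 2 - C a * X) ^ 2)) := by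
    simp only [mapNum, mapDen, map_sub, map_mul, map_pow, aeval_X, aeval_C]
    rw [inv_div]
    field_simp
  have hv := hP.takesValue_div (hP.takesValue_aeval ht (C ((a - 1) ^ 2) * X - C (2 * a - 3)))
    (hP.takesValue_aeval ht ((C 2 - C a * X) ^ 2)) (by simp)
  rw [he, map_mul, map_pow, hP.valuation_eq_one hv (div_ne_zero ?_ (by simp)), mul_one]
  intro h
  apply A.two_a
  simp only [eval_sub, eval_mul, eval_C, eval_X, mul_zero, zero_sub] at h
  exact neg_eq_zero.1 h

end Admissible

end Valuation

/-! ### Places of the line -/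

section RatFuncPlaces

/-- The place `P` of the line lies over infinity. -/
def IsInfinite (P : ValuationSubring (RatFunc ℂ)) : Prop := P.valuation (RatFunc.X)⁻¹ < 1

variable {P Q : ValuationSubring (RatFunc ℂ)}

lemma takesValue_one {L : Type} [Field L] [Algebra ℂ L] (P : ValuationSubring L) :
    TakesValue P (1 : L) 1 := by
  simpa using takesValue_const P 1

lemma isUniformizer_finite (hP : ContainsConstants P) {r : ℂ} (h : TakesValue P RatFunc.X r) :
    IsUniformizer P (RatFunc.X - algebraMap ℂ (RatFunc ℂ) r) :=
  (ratFunc_model.local_of_ne hP h (takesValue_one P) one_ne_zero).1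

lemma isUniformizer_infinite (hP : ContainsConstants P) (h : IsInfinite P) :
    IsUniformizer P (RatFunc.X)⁻¹ := by
  simpa using (ratFunc_model_infinity.local_of_ne hP (takesValue_zero.2 h)
    (takesValue_one P) one_ne_zero).1

lemma finite_place_unique (hP : ContainsConstants P) (hQ : ContainsConstants Q) {r : ℂ}
    (h : TakesValue P RatFunc.X r) (h' : TakesValue Q RatFunc.X r) : P = Q :=
  ratFunc_model.place_unique hP h (takesValue_one P) (Or.inl (by simp)) hQ h' (takesValue_one Q)

lemma infinite_place_unique (hP : ContainsConstants P) (hQ : ContainsConstants Q)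
    (h : IsInfinite P) (h' : IsInfinite Q) : P = Q :=
  ratFunc_model_infinity.place_unique hP (takesValue_zero.2 h) (takesValue_one P)
    (Or.inl (by simp)) hQ (takesValue_zero.2 h') (takesValue_one Q)

lemma infinite_or_finite (hP : P ∈ points (RatFunc ℂ)) :
    IsInfinite P ∨ ∃ r, TakesValue P RatFunc.X r := by
  by_cases hx : RatFunc.X ∈ P
  · exact Or.inr (ratFunc_model.exists_takesValue_x hP.1 hP.2 hx)
  · exact Or.inl (valuation_inv_lt_one hx)

lemma IsInfinite.not_takesValue (h : IsInfinite P) (hP : ContainsConstants P) (r : ℂ) :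
    ¬ TakesValue P RatFunc.X r := by
  intro h'
  have h1 := hP.valuation_le_one h'
  have h2 : P.valuation (RatFunc.X * (RatFunc.X)⁻¹) < 1 := by
    rw [mul_comm, map_mul]
    exact mul_lt_one_of_lt_of_le h h1
  rw [mul_inv_cancel₀ ratFunc_transcendental.ne_zero', map_one] at h2
  exact h2.ne rfl

end RatFuncPlaces

/-! ### The Frey-Kani covering -/

section FreyKani

variable {a c t s : ℂ} (A : Admissible a c t s) {φ : RatFunc ℂ →ₐ[ℂ] RatFunc ℂ}
  (hφ : φ RatFunc.X = aeval RatFunc.X (mapNum a) / aeval RatFunc.X (mapDen a))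
include A

lemma Admissible.map_transcendental {L : Type} [Field L] [Algebra ℂ L] {x : L}
    (hx : Transcendental ℂ x) :
    Transcendental ℂ (aeval x (mapNum a) / aeval x (mapDen a)) := by
  intro halg
  -- an algebraic element is constant, but the map has a zero and a pole
  obtain ⟨P, hP, hlt⟩ := exists_point_valuation_lt_one (transcendental_inv hx)
  have hinf := A.valuation_inv_map_infinity hP.1 hlt hx
  have hlt' : P.valuation (aeval x (mapNum a) / aeval x (mapDen a))⁻¹ < 1 := by
    rw [hinf]
    exact pow_lt_one₀ zero_le hlt two_ne_zero
  have hmem : (aeval x (mapNum a) / aeval x (mapDen a))⁻¹ ∈ integralClosure ℂ L :=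
    halg.inv.isIntegral
  obtain ⟨r, hr⟩ := (IsAlgClosed.algebraMap_bijective_of_isIntegral (k := ℂ)
    (K := integralClosure ℂ L)).2 ⟨_, hmem⟩
  have hr' : algebraMap ℂ L r = (aeval x (mapNum a) / aeval x (mapDen a))⁻¹ :=
    congrArg Subtype.val hr
  rw [← hr'] at hlt'
  rw [ContainsConstants.eq_zero_of_valuation_lt_one hP.1 hlt', map_zero, zero_eq_inv] at hr'
  exact div_ne_zero (A.num_ne_zero' hx) (A.den_ne_zero hx) hr'.symm

include hφ

theorem Admissible.coverDegree_map : coverDegree φ = 3 := by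
  have h2 := A.two_a
  have hD : mapDen a ≠ 0 := by
    intro h
    apply A.den_ne_zero ratFunc_transcendental
    rw [h, map_zero]
  rw [RatFunc.aeval_X_left_eq_algebraMap, RatFunc.aeval_X_left_eq_algebraMap] at hφ
  have hcop : IsCoprime (mapNum a) (mapDen a) := by
    rw [Polynomial.isCoprime_iff_aeval_ne_zero_of_isAlgClosed ℂ ℂ]
    intro x
    by_contra! h
    simp only [coe_aeval_eq_eval] at h
    exact A.num_ne_zero h.2 h.1
  rw [coverDegree_of_isCoprime φ hcop hD hφ]
  have h3 : (mapNum a).natDegree = 3 := by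
    have h : (C 2 * X - C a : ℂ[X]).natDegree = 1 := by compute_degree!
    have h0 : (C 2 * X - C a : ℂ[X]) ≠ 0 := by
      rintro h0
      rw [h0] at h
      simp at h
    rw [mapNum, natDegree_mul X_ne_zero (pow_ne_zero 2 h0), natDegree_X, natDegree_pow, h]
  have h1 : (mapDen a).natDegree ≤ 1 := by
    unfold mapDen
    compute_degree
  rw [h3]
  omega

lemma Admissible.map_infinite {P : ValuationSubring (RatFunc ℂ)} (hP : ContainsConstants P)
    (h : IsInfinite P) : IsInfinite (image φ P) ∧ ramIndex φ P = 2 := by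
  have hv : P.valuation (φ (RatFunc.X)⁻¹) = P.valuation (RatFunc.X)⁻¹ ^ 2 := by
    rw [map_inv₀, hφ]
    exact A.valuation_inv_map_infinity hP h ratFunc_transcendental
  have hi : IsInfinite (image φ P) := by
    rw [IsInfinite, image_valuation_lt_one_iff, hv]
    exact pow_lt_one₀ zero_le h two_ne_zero
  exact ⟨hi, ramIndex_eq 2 (isUniformizer_infinite (hP.image φ) hi)
    (isUniformizer_infinite hP h) hv⟩

lemma Admissible.map_pole {P : ValuationSubring (RatFunc ℂ)} (hP : ContainsConstants P)
    {x₀ : ℂ} (h : TakesValue P RatFunc.X x₀) (hD : (mapDen a).eval x₀ = 0) :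
    IsInfinite (image φ P) ∧ ramIndex φ P = 1 := by
  have hv : P.valuation (φ (RatFunc.X)⁻¹) =
      P.valuation (RatFunc.X - algebraMap ℂ (RatFunc ℂ) x₀) ^ 1 := by
    rw [map_inv₀, hφ, pow_one]
    exact A.valuation_inv_map_of_pole hP h hD
  have hi : IsInfinite (image φ P) := by
    rw [IsInfinite, image_valuation_lt_one_iff, hv, pow_one]
    exact h
  exact ⟨hi, ramIndex_eq 1 (isUniformizer_infinite (hP.image φ) hi)
    (isUniformizer_finite hP h) hv⟩

lemma Admissible.map_finite {P : ValuationSubring (RatFunc ℂ)} (hP : ContainsConstants P)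
    {x₀ : ℂ} (h : TakesValue P RatFunc.X x₀) (hD : (mapDen a).eval x₀ ≠ 0) :
    TakesValue (image φ P) RatFunc.X ((mapNum a).eval x₀ / (mapDen a).eval x₀) ∧
      ((mapRam a).eval x₀ = 0 → ramIndex φ P = 2) ∧
      ((mapRam a).eval x₀ ≠ 0 → ramIndex φ P = 1) := by
  have hi : TakesValue (image φ P) RatFunc.X ((mapNum a).eval x₀ / (mapDen a).eval x₀) := by
    rw [takesValue_image, hφ]
    exact takesValue_map hP h hD
  refine ⟨hi, fun hR => ?_, fun hR => ?_⟩
  · refine ramIndex_eq 2 (isUniformizer_finite (hP.image φ) hi) (isUniformizer_finite hP h) ?_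
    rw [map_sub, AlgHom.commutes, hφ]
    exact A.valuation_map_of_ramified hP h ratFunc_transcendental hD hR
  · refine ramIndex_eq 1 (isUniformizer_finite (hP.image φ) hi) (isUniformizer_finite hP h) ?_
    rw [map_sub, AlgHom.commutes, hφ, pow_one]
    exact A.valuation_map_of_unramified hP h ratFunc_transcendental hD hR

/-- The places of the line at which the covering is ramified. -/
lemma Admissible.ramified_cases {P : ValuationSubring (RatFunc ℂ)} (hP : P ∈ points (RatFunc ℂ)) :
    ramIndex φ P = 1 ∨ ramIndex φ P = 2 ∧ ((IsInfinite P ∧ IsInfinite (image φ P)) ∨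
      (TakesValue P RatFunc.X (a / 2) ∧ TakesValue (image φ P) RatFunc.X 0) ∨
      (TakesValue P RatFunc.X ((a - 1) / 2) ∧ TakesValue (image φ P) RatFunc.X 1) ∨
      (TakesValue P RatFunc.X (a * (a - 1) / (2 * a - 3) / 2) ∧
        TakesValue (image φ P) RatFunc.X t)) := by
  have hPc : ContainsConstants P := hP.1
  rcases infinite_or_finite hP with h | ⟨x₀, h⟩
  · obtain ⟨h1, h2⟩ := A.map_infinite hφ hPc h
    exact Or.inr ⟨h2, Or.inl ⟨h, h1⟩⟩
  by_cases hD : (mapDen a).eval x₀ = 0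
  · exact Or.inl (A.map_pole hφ hPc h hD).2
  obtain ⟨h1, h2, h3⟩ := A.map_finite hφ hPc h hD
  by_cases hR : (mapRam a).eval x₀ = 0
  · refine Or.inr ⟨h2 hR, Or.inr ?_⟩
    rcases (ram_eq_zero_iff a x₀).1 hR with rfl | rfl | rfl
    · rw [map_half] at h1
      exact Or.inl ⟨h, h1⟩
    · rw [A.map_half'] at h1
      exact Or.inr (Or.inl ⟨h, h1⟩)
    · rw [A.map_third] at h1
      exact Or.inr (Or.inr ⟨h, h1⟩)
  · exact Or.inl (h3 hR)

lemma Admissible.ramIndex_eq_one_or_two {P : ValuationSubring (RatFunc ℂ)}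
    (hP : P ∈ points (RatFunc ℂ)) : ramIndex φ P = 1 ∨ ramIndex φ P = 2 :=
  (A.ramified_cases hφ hP).imp_right And.left

/-- A fibre that contains a ramified point has ramification type `(2)¹`, if each ramified place in
it takes the value `x₀`. -/
lemma Admissible.fibreType_finite {q : ValuationSubring (RatFunc ℂ)} (hq : ContainsConstants q)
    {x₀ z₀ : ℂ} (hqz : TakesValue q RatFunc.X z₀) (hD : (mapDen a).eval x₀ ≠ 0)
    (hR : (mapRam a).eval x₀ = 0) (hz : (mapNum a).eval x₀ / (mapDen a).eval x₀ = z₀)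
    (hu : ∀ P ∈ points (RatFunc ℂ), image φ P = q → ramIndex φ P = 2 →
      TakesValue P RatFunc.X x₀) : FibreType φ q 1 := by
  refine ⟨?_, fun P hP _ => A.ramIndex_eq_one_or_two hφ hP⟩
  obtain ⟨P₀, hP₀, h₀⟩ := exists_point_takesValue ratFunc_transcendental x₀
  rw [Nat.cast_one, Set.encard_eq_one]
  refine ⟨P₀, Set.eq_singleton_iff_unique_mem.2 ⟨⟨hP₀, ?_, ?_⟩, ?_⟩⟩
  · obtain ⟨h1, -⟩ := A.map_finite hφ hP₀.1 h₀ hD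
    rw [hz] at h1
    exact finite_place_unique (ContainsConstants.image hP₀.1 φ) hq h1 hqz
  · exact (A.map_finite hφ hP₀.1 h₀ hD).2.1 hR
  · rintro P ⟨hP, h1, h2⟩
    exact finite_place_unique hP.1 hP₀.1 (hu P hP h1 h2) h₀

theorem Admissible.hasGenericRamification
    (hbranch : ∀ q : ValuationSubring (RatFunc ℂ), q ∈ branchPoints (proj (quartic t s)) ↔
      ContainsConstants q ∧ (TakesValue q RatFunc.X 0 ∨ TakesValue q RatFunc.X 1 ∨
        TakesValue q RatFunc.X t ∨ TakesValue q RatFunc.X s)) :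
    HasGenericRamification (quartic t s) φ 3 := by
  obtain ⟨q₀, hq₀, h₀⟩ := exists_point_takesValue ratFunc_transcendental 0
  obtain ⟨q₁, hq₁, h₁⟩ := exists_point_takesValue ratFunc_transcendental 1
  obtain ⟨q₂, hq₂, h₂⟩ := exists_point_takesValue ratFunc_transcendental t
  obtain ⟨q₃, hq₃, h₃⟩ := exists_point_takesValue ratFunc_transcendental s
  obtain ⟨q₄, hq₄, h₄⟩ := exists_point_valuation_lt_one (transcendental_inv ratFunc_transcendental)
  have ht0 := A.t_zero
  have ht1 := A.t_one
  have hs0 := A.s_zero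
  have hs1 := A.s_one
  have hst := A.s_t
  have hinf : ∀ {P : ValuationSubring (RatFunc ℂ)} {r : ℂ}, ContainsConstants P → IsInfinite P →
      TakesValue P RatFunc.X r → False := fun hP hi hv => hi.not_takesValue hP _ hv
  have huniq : ∀ {P : ValuationSubring (RatFunc ℂ)} {r r' : ℂ}, ContainsConstants P →
      TakesValue P RatFunc.X r → TakesValue P RatFunc.X r' → r = r' :=
    fun hP h h' => hP.takesValue_unique h h'
  have hne : ∀ {P Q : ValuationSubring (RatFunc ℂ)} {r r' : ℂ}, ContainsConstants P →
      TakesValue P RatFunc.X r → TakesValue Q RatFunc.X r' → r ≠ r' → P ≠ Q := by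
    rintro P Q r r' hP h h' hr rfl
    exact hr (huniq hP h h')
  have hne' : ∀ {P : ValuationSubring (RatFunc ℂ)} {r : ℂ}, ContainsConstants P →
      TakesValue P RatFunc.X r → P ≠ q₄ := by
    rintro P r hP h rfl
    exact hinf hP h₄ h
  refine ⟨![q₀, q₁, q₂, q₃, q₄], ?_, ?_, ?_, ?_, ?_, ?_, ?_, ?_, ?_⟩
  · have h01 := hne hq₀.1 h₀ h₁ zero_ne_one
    have h02 := hne hq₀.1 h₀ h₂ ht0.symm
    have h03 := hne hq₀.1 h₀ h₃ hs0.symm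
    have h12 := hne hq₁.1 h₁ h₂ ht1.symm
    have h13 := hne hq₁.1 h₁ h₃ hs1.symm
    have h23 := hne hq₂.1 h₂ h₃ hst.symm
    have h04 := hne' hq₀.1 h₀
    have h14 := hne' hq₁.1 h₁
    have h24 := hne' hq₂.1 h₂
    have h34 := hne' hq₃.1 h₃
    intro i j
    fin_cases i <;> fin_cases j <;> simp [h01, h02, h03, h12, h13, h23, h04, h14, h24, h34,
      h01.symm, h02.symm, h03.symm, h12.symm, h13.symm, h23.symm, h04.symm, h14.symm, h24.symm,
      h34.symm]
  · intro i
    fin_cases i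
    exacts [hq₀, hq₁, hq₂, hq₃, hq₄]
  · ext q
    rw [hbranch]
    change _ ↔ q = q₀ ∨ q = q₁ ∨ q = q₂ ∨ q = q₃
    constructor
    · rintro ⟨hq, h | h | h | h⟩
      · exact Or.inl (finite_place_unique hq hq₀.1 h h₀)
      · exact Or.inr (Or.inl (finite_place_unique hq hq₁.1 h h₁))
      · exact Or.inr (Or.inr (Or.inl (finite_place_unique hq hq₂.1 h h₂)))
      · exact Or.inr (Or.inr (Or.inr (finite_place_unique hq hq₃.1 h h₃)))
    · rintro (rfl | rfl | rfl | rfl)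
      exacts [⟨hq₀.1, Or.inl h₀⟩, ⟨hq₁.1, Or.inr (Or.inl h₁)⟩, ⟨hq₂.1, Or.inr (Or.inr (Or.inl h₂))⟩,
        ⟨hq₃.1, Or.inr (Or.inr (Or.inr h₃))⟩]
  · refine A.fibreType_finite hφ hq₀.1 h₀ A.den_half ((ram_eq_zero_iff a _).2 (Or.inl rfl))
      (map_half a) ?_
    rintro P hP rfl h2
    rcases A.ramified_cases hφ hP with h | ⟨-, ⟨-, h⟩ | ⟨h, -⟩ | ⟨-, h⟩ | ⟨-, h⟩⟩
    · omega
    · exact (hinf hq₀.1 h h₀).elim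
    · exact h
    · exact (one_ne_zero (huniq hq₀.1 h h₀)).elim
    · exact (ht0 (huniq hq₀.1 h h₀)).elim
  · refine A.fibreType_finite hφ hq₁.1 h₁ A.den_half'
      ((ram_eq_zero_iff a _).2 (Or.inr (Or.inl rfl))) A.map_half' ?_
    rintro P hP rfl h2
    rcases A.ramified_cases hφ hP with h | ⟨-, ⟨-, h⟩ | ⟨-, h⟩ | ⟨h, -⟩ | ⟨-, h⟩⟩
    · omega
    · exact (hinf hq₁.1 h h₁).elim
    · exact (zero_ne_one (huniq hq₁.1 h h₁)).elim
    · exact h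
    · exact (ht1 (huniq hq₁.1 h h₁)).elim
  · refine A.fibreType_finite hφ hq₂.1 h₂ A.den_third
      ((ram_eq_zero_iff a _).2 (Or.inr (Or.inr rfl))) A.map_third ?_
    rintro P hP rfl h2
    rcases A.ramified_cases hφ hP with h | ⟨-, ⟨-, h⟩ | ⟨-, h⟩ | ⟨-, h⟩ | ⟨h, -⟩⟩
    · omega
    · exact (hinf hq₂.1 h h₂).elim
    · exact (ht0 (huniq hq₂.1 h₂ h)).elim
    · exact (ht1 (huniq hq₂.1 h₂ h)).elim
    · exact h
  · refine ⟨?_, fun P hP _ => A.ramIndex_eq_one_or_two hφ hP⟩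
    rw [show (3 - 3) / 2 = 0 by norm_num, Nat.cast_zero, Set.encard_eq_zero,
      Set.eq_empty_iff_forall_notMem]
    rintro P ⟨hP, h1, h2⟩
    have h1 : image φ P = q₃ := h1
    subst h1
    rcases A.ramified_cases hφ hP with h | ⟨-, ⟨-, h⟩ | ⟨-, h⟩ | ⟨-, h⟩ | ⟨-, h⟩⟩
    · omega
    · exact hinf hq₃.1 h h₃
    · exact hs0 (huniq hq₃.1 h₃ h)
    · exact hs1 (huniq hq₃.1 h₃ h)
    · exact hst (huniq hq₃.1 h₃ h)
  · refine ⟨?_, fun P hP _ => A.ramIndex_eq_one_or_two hφ hP⟩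
    rw [Nat.cast_one, Set.encard_eq_one]
    obtain ⟨h1, h2⟩ := A.map_infinite hφ hq₄.1 h₄
    have h3 : image φ q₄ = q₄ :=
      infinite_place_unique (ContainsConstants.image hq₄.1 φ) hq₄.1 h1 h₄
    refine ⟨q₄, Set.eq_singleton_iff_unique_mem.2 ⟨⟨hq₄, h3, h2⟩, ?_⟩⟩
    rintro P ⟨hP, h4, h5⟩
    have h4 : image φ P = q₄ := h4
    have h6 : ∀ r, ¬ TakesValue (image φ P) RatFunc.X r := by
      rw [h4]
      exact fun r => IsInfinite.not_takesValue h₄ hq₄.1 r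
    rcases A.ramified_cases hφ hP with h | ⟨-, ⟨h, -⟩ | ⟨-, h⟩ | ⟨-, h⟩ | ⟨-, h⟩⟩
    · omega
    · exact infinite_place_unique hP.1 hq₄.1 h h₄
    all_goals exact (h6 _ h).elim
  · intro P hP hnot
    have hPi := ContainsConstants.image hP.1 φ
    rcases A.ramified_cases hφ hP with h | ⟨-, ⟨-, h⟩ | ⟨-, h⟩ | ⟨-, h⟩ | ⟨-, h⟩⟩
    · exact h
    · exact (hnot ⟨4, (infinite_place_unique hPi hq₄.1 h h₄).symm⟩).elim
    · exact (hnot ⟨0, (finite_place_unique hPi hq₀.1 h h₀).symm⟩).elim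
    · exact (hnot ⟨1, (finite_place_unique hPi hq₁.1 h h₁).symm⟩).elim
    · exact (hnot ⟨2, (finite_place_unique hPi hq₂.1 h h₂).symm⟩).elim

end FreyKani

/-! ### The covering of the elliptic curve -/

section Quartic

variable (t s : ℂ)

variable {t s} in
lemma quartic_model_infinity {L : Type} [Field L] [Algebra ℂ L] {z y : L}
    (M : IsModel (quartic t s) z y) :
    IsModel ((1 - X) * (1 - C t * X) * (1 - C s * X)) z⁻¹ (y / z ^ 2) := by
  refine M.infinity _ 2 ?_
  have hz := M.transc.ne_zero'
  simp only [quartic, map_mul, map_sub, map_one, aeval_X, aeval_C]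
  field_simp
  ring

lemma quartic_eval_eq_zero_iff (z : ℂ) :
    (quartic t s).eval z = 0 ↔ z = 0 ∨ z = 1 ∨ z = t ∨ z = s := by
  simp [quartic, sub_eq_zero, or_assoc]

variable {t s}

/-- The branch points of the projection from the curve are the roots of the quartic. -/
theorem mem_branchPoints_iff (hG : Squarefree (quartic t s)) (q : ValuationSubring (RatFunc ℂ)) :
    q ∈ branchPoints (proj (quartic t s)) ↔ ContainsConstants q ∧
      (TakesValue q RatFunc.X 0 ∨ TakesValue q RatFunc.X 1 ∨
        TakesValue q RatFunc.X t ∨ TakesValue q RatFunc.X s) := by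
  have M := curve_model (quartic t s)
  have M' := quartic_model_infinity (curve_model (quartic t s))
  have hsm := eval_or_derivative_ne_zero hG
  have hval : ∀ (P : ValuationSubring (CurveField (quartic t s))) (r : ℂ),
      TakesValue (image (proj (quartic t s)) P) RatFunc.X r ↔
      TakesValue P (curveX (quartic t s)) r := fun P r => takesValue_image _ _ _ _
  have hroot : (∃ r, (quartic t s).eval r = 0 ∧ TakesValue q RatFunc.X r) ↔
      (TakesValue q RatFunc.X 0 ∨ TakesValue q RatFunc.X 1 ∨
        TakesValue q RatFunc.X t ∨ TakesValue q RatFunc.X s) := by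
    simp only [quartic_eval_eq_zero_iff, or_and_right, exists_or, exists_eq_left]
  rw [← hroot]
  constructor
  · rintro ⟨P, hP, rfl, hram⟩
    have hPc : ContainsConstants P := hP.1
    refine ⟨hPc.image _, ?_⟩
    by_cases hx : curveX (quartic t s) ∈ P
    · obtain ⟨r, hr⟩ := M.exists_takesValue_x hPc hP.2 hx
      obtain ⟨y, hy⟩ := M.exists_takesValue_Y hPc hr
      refine ⟨r, ?_, (hval P r).2 hr⟩
      by_contra hne
      apply hram
      have hy0 : y ≠ 0 := by
        rintro rfl
        apply hne
        rw [← M.eval_eq hPc hr hy]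
        simp
      refine ramIndex_eq 1 (isUniformizer_finite (hPc.image _) ((hval P r).2 hr))
        (M.local_of_ne hPc hr hy hy0).1 ?_
      rw [map_sub, AlgHom.commutes, pow_one]
      rfl
    · exfalso
      apply hram
      have ht := takesValue_zero.2 (valuation_inv_lt_one hx)
      obtain ⟨y, hy⟩ := M'.exists_takesValue_Y hPc ht
      have hy0 : y ≠ 0 := by
        rintro rfl
        have := M'.eval_eq hPc ht hy
        simp at this
      have hi : IsInfinite (image (proj (quartic t s)) P) := by
        rw [IsInfinite, image_valuation_lt_one_iff, map_inv₀]
        exact valuation_inv_lt_one hx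
      have hu := (M'.local_of_ne hPc ht hy hy0).1
      rw [map_zero, sub_zero] at hu
      refine ramIndex_eq 1 (isUniformizer_infinite (hPc.image _) hi) hu ?_
      rw [map_inv₀, pow_one]
      rfl
  · rintro ⟨hq, r, hr, hqr⟩
    obtain ⟨P, hP, hPr⟩ := exists_point_takesValue (curveX_transcendental (quartic t s)) r
    have hPc : ContainsConstants P := hP.1
    have hi := (hval P r).2 hPr
    refine ⟨P, hP, finite_place_unique (hPc.image _) hq hi hqr, ?_⟩
    have hd := (hsm r).resolve_left (not_not.2 hr)
    rw [ramIndex_eq 2 (isUniformizer_finite (hPc.image _) hi) (M.local_of_eq hPc hPr hr hd).1]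
    · decide
    · rw [← map_pow, M.eqn, valuation_of_simple_root hPc hPr hr hd, map_sub, AlgHom.commutes]
      rfl

end Quartic

section Sextic

variable {a c t s : ℂ}

lemma sextic_not_isUnit : ¬ IsUnit (sextic a c) := by
  intro h
  have := h.map (evalRingHom 0)
  simp [sextic] at this

lemma quartic_not_isUnit : ¬ IsUnit (quartic t s) := by
  intro h
  have := h.map (evalRingHom 0)
  simp [quartic] at this

/-- The sextic read at infinity. -/
def sexticInfinity (a c : ℂ) : ℂ[X] :=
  (1 - X) * (1 - C (a * (a - 2) / (2 * a - 3)) * X) *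
    (1 - C a * X + C ((2 * a - 3) * c / (a - 1) ^ 2 + a ^ 2 / 4) * X ^ 2 - C c * X ^ 3)

lemma sexticInfinity_eval_zero : (sexticInfinity a c).eval 0 = 1 := by
  simp [sexticInfinity]

variable {L : Type} [Field L] [Algebra ℂ L] {x Y : L}

lemma sextic_model_infinity (M : IsModel (sextic a c) x Y) :
    IsModel (sexticInfinity a c) x⁻¹ (Y / x ^ 3) := by
  refine M.infinity _ 3 ?_
  have hx := M.transc.ne_zero'
  simp only [sextic, sexticInfinity, map_mul, map_sub, map_add, map_pow, map_one, aeval_X, aeval_C]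
  field_simp
  ring

lemma IsModel.neg {F : ℂ[X]} (M : IsModel F x Y) : IsModel F x (-Y) := by
  refine M.of_mem (by rw [neg_sq, M.eqn]) M.transc
    (IntermediateField.subset_adjoin _ _ (by simp)) ?_
  rw [← neg_neg Y]
  exact neg_mem (by rw [neg_neg]; exact IntermediateField.subset_adjoin _ _ (by simp))

/-- The pullback of the quartic is a square on the sextic curve. -/
lemma Admissible.quartic_pullback (A : Admissible a c t s) (M : IsModel (sextic a c) x Y) :
    (Y * aeval x (mapRam a) / aeval x (mapDen a) ^ 2) ^ 2 =
      aeval (aeval x (mapNum a) / aeval x (mapDen a)) (quartic t s) := by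
  have hD := A.den_ne_zero M.transc
  have h := congrArg (aeval x) A.identity
  simp only [map_mul, map_sub, map_pow, aeval_C] at h
  rw [← M.eqn] at h
  simp only [quartic, map_mul, map_sub, map_one, aeval_X, aeval_C]
  field_simp
  linear_combination -h

variable (A : Admissible a c t s) (M : IsModel (sextic a c) x Y) (hF : Squarefree (sextic a c))
  {ψ : CurveField (quartic t s) →ₐ[ℂ] L}
  (hψX : ψ (curveX (quartic t s)) = aeval x (mapNum a) / aeval x (mapDen a))
  (hψY : ψ (curveY (quartic t s)) = Y * aeval x (mapRam a) / aeval x (mapDen a) ^ 2)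
include A M hψX

/-- Over `x = ∞` the covering is ramified with index `2`. -/
lemma Admissible.ramIndex_infinite {P : ValuationSubring L} (hP : ContainsConstants P)
    (hx : P.valuation x⁻¹ < 1) : ramIndex ψ P = 2 := by
  have M' := sextic_model_infinity M
  have N' := quartic_model_infinity (curve_model (quartic t s))
  have hv : P.valuation (ψ (curveX (quartic t s))⁻¹) = P.valuation x⁻¹ ^ 2 := by
    rw [map_inv₀, hψX]
    exact A.valuation_inv_map_infinity hP hx M.transc
  have hQ := hP.image ψ
  have hz : TakesValue (image ψ P) (curveX (quartic t s))⁻¹ 0 := by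
    rw [takesValue_zero, image_valuation_lt_one_iff, hv]
    exact pow_lt_one₀ zero_le hx two_ne_zero
  have ht := takesValue_zero.2 hx
  obtain ⟨y, hy⟩ := M'.exists_takesValue_Y hP ht
  obtain ⟨w, hw⟩ := N'.exists_takesValue_Y hQ hz
  have hy0 : y ≠ 0 := by
    rintro rfl
    have := M'.eval_eq hP ht hy
    simp [sexticInfinity_eval_zero] at this
  have hw0 : w ≠ 0 := by
    rintro rfl
    have := N'.eval_eq hQ hz hw
    simp at this
  have hu := (M'.local_of_ne hP ht hy hy0).1
  have hu' := (N'.local_of_ne hQ hz hw hw0).1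
  rw [map_zero, sub_zero] at hu hu'
  exact ramIndex_eq 2 hu' hu hv

include hψY hF

/-- Over finite values of `x` the covering is unramified. Above a ramification point of the cubic
map the ramification is absorbed by that of `z` on the elliptic curve; at a branch point of `x` the
map and `z` ramify to the same order. -/
lemma Admissible.ramIndex_finite {P : ValuationSubring L} (hP : ContainsConstants P)
    {x₀ : ℂ} (hx : TakesValue P x x₀) : ramIndex ψ P = 1 := by
  have hG := squarefree_quartic A.t_zero A.t_one A.s_zero A.s_one A.s_t
  have N := curve_model (quartic t s)
  have hsm := eval_or_derivative_ne_zero hF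
  have hQ := hP.image ψ
  obtain ⟨y, hy⟩ := M.exists_takesValue_Y hP hx
  have hyF := M.eval_eq hP hx hy
  have hid := congrArg (eval x₀) A.identity
  simp only [eval_mul, eval_sub, eval_pow, eval_C] at hid
  have hunif : (sextic a c).eval x₀ ≠ 0 → IsUniformizer P (x - algebraMap ℂ L x₀) := by
    intro h
    refine (M.local_of_ne hP hx hy ?_).1
    rintro rfl
    apply h
    rw [← hyF]
    simp
  by_cases hD : (mapDen a).eval x₀ = 0
  · have hF0 : (sextic a c).eval x₀ ≠ 0 := by
      intro h
      rw [h, hD] at hid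
      simp [A.num_ne_zero hD] at hid
    have N' := quartic_model_infinity (curve_model (quartic t s))
    have hv : P.valuation (ψ (curveX (quartic t s))⁻¹) =
        P.valuation (x - algebraMap ℂ L x₀) ^ 1 := by
      rw [map_inv₀, hψX, pow_one]
      exact A.valuation_inv_map_of_pole hP hx hD
    have hz : TakesValue (image ψ P) (curveX (quartic t s))⁻¹ 0 := by
      rw [takesValue_zero, image_valuation_lt_one_iff, hv, pow_one]
      exact hx
    obtain ⟨w, hw⟩ := N'.exists_takesValue_Y hQ hz
    have hw0 : w ≠ 0 := by
      rintro rfl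
      have := N'.eval_eq hQ hz hw
      simp at this
    have hu' := (N'.local_of_ne hQ hz hw hw0).1
    rw [map_zero, sub_zero] at hu'
    exact ramIndex_eq 1 hu' (hunif hF0) hv
  set z₀ := (mapNum a).eval x₀ / (mapDen a).eval x₀ with hz₀
  have hz : TakesValue (image ψ P) (curveX (quartic t s)) z₀ := by
    rw [takesValue_image, hψX]
    exact takesValue_map hP hx hD
  have hnum : (mapNum a).eval x₀ = z₀ * (mapDen a).eval x₀ := (div_mul_cancel₀ _ hD).symm
  have hid' : (quartic t s).eval z₀ * (mapDen a).eval x₀ ^ 4 =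
      (sextic a c).eval x₀ * (mapRam a).eval x₀ ^ 2 := by
    rw [← hid, hnum]
    simp only [quartic, eval_mul, eval_sub, eval_X, eval_C, eval_one]
    ring
  have hDv : P.valuation (aeval x (mapDen a)) = 1 :=
    hP.valuation_eq_one (hP.takesValue_aeval hx _) hD
  by_cases hG0 : (quartic t s).eval z₀ = 0
  · have hGd := (eval_or_derivative_ne_zero hG z₀).resolve_left (not_not.2 hG0)
    have hu := (N.local_of_eq hQ hz hG0 hGd).1
    rw [hG0, zero_mul] at hid'
    by_cases hF0 : (sextic a c).eval x₀ = 0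
    · -- `x₀` is a branch point of `x`, hence not a ramification point of the cubic map
      have hR : (mapRam a).eval x₀ ≠ 0 := fun h => A.sextic_ne_zero_of_ram h hF0
      refine ramIndex_eq 1 hu (M.local_of_eq hP hx hF0
        ((hsm x₀).resolve_left (not_not.2 hF0))).1 ?_
      rw [hψY, map_div₀, map_mul, map_pow, hDv,
        hP.valuation_eq_one (hP.takesValue_aeval hx _) hR, one_pow, div_one, mul_one, pow_one]
    · have hR : (mapRam a).eval x₀ = 0 := by
        simpa [hF0] using hid'.symm
      refine ramIndex_eq 1 hu (hunif hF0) ?_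
      have hYv : P.valuation Y = 1 := by
        refine hP.valuation_eq_one hy ?_
        rintro rfl
        apply hF0
        rw [← hyF]
        simp
      rw [hψY, map_div₀, map_mul, map_pow, hDv, hYv, one_pow, div_one, one_mul, pow_one]
      exact valuation_of_simple_root hP hx hR (A.ram_derivative_ne_zero hR)
  · have hne : (sextic a c).eval x₀ * (mapRam a).eval x₀ ^ 2 ≠ 0 := by
      rw [← hid']
      exact mul_ne_zero hG0 (pow_ne_zero 4 hD)
    have hF0 := left_ne_zero_of_mul hne
    have hR : (mapRam a).eval x₀ ≠ 0 := fun h => by simp [h] at hne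
    obtain ⟨w, hw⟩ := N.exists_takesValue_Y hQ hz
    have hw0 : w ≠ 0 := by
      rintro rfl
      apply hG0
      rw [← N.eval_eq hQ hz hw]
      simp
    refine ramIndex_eq 1 (N.local_of_ne hQ hz hw hw0).1 (hunif hF0) ?_
    rw [map_sub, AlgHom.commutes, hψX, pow_one]
    exact A.valuation_map_of_unramified hP hx M.transc hD hR

/-- The two points over `x = ∞` are the ramified points, and they have different images. -/
theorem Admissible.isCaseOne (τ : L →ₐ[ℂ] L) (hτx : τ x = x) (hτY : τ Y = -Y) : IsCaseOne ψ := by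
  have M' := sextic_model_infinity M
  have hxt := transcendental_inv M.transc
  have hx0 := M.transc.ne_zero'
  obtain ⟨P₁, hP₁, h₁⟩ := exists_point_valuation_lt_one hxt
  have hP₁c : ContainsConstants P₁ := hP₁.1
  have ht₁ := takesValue_zero.2 h₁
  obtain ⟨y, hy₁⟩ := M'.exists_takesValue_Y hP₁c ht₁
  have hy := M'.eval_eq hP₁c ht₁ hy₁
  have hP₂c : ContainsConstants (image τ P₁) := hP₁c.image τ
  have ht₂ : TakesValue (image τ P₁) x⁻¹ 0 := by
    rw [takesValue_image, map_inv₀, hτx]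
    exact ht₁
  have hy₂ : TakesValue (image τ P₁) (Y / x ^ 3) (-y) := by
    rw [takesValue_image, map_div₀, map_pow, hτx, hτY, neg_div]
    exact hP₁c.takesValue_neg hy₁
  have h₂ := takesValue_zero.1 ht₂
  -- the function `y / z²` separates the images
  have hval : ∀ {P : ValuationSubring L} {r : ℂ}, ContainsConstants P → TakesValue P x⁻¹ 0 →
      TakesValue P (Y / x ^ 3) r →
      TakesValue (image ψ P) (curveY (quartic t s) / curveX (quartic t s) ^ 2) r := by
    intro P r hP ht hr
    have hD := A.den_ne_zero M.transc
    have hN := A.num_ne_zero' M.transc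
    set R' : ℂ[X] := C 2 * (C 2 - C a * X) * (C 2 - C (a - 1) * X) *
      (C 2 - C (a * (a - 1) / (2 * a - 3)) * X)
    set N' : ℂ[X] := (C 2 - C a * X) ^ 2
    have hN' : aeval x (mapNum a) = x ^ 3 * aeval x⁻¹ N' := by
      simp only [mapNum, N', map_mul, map_sub, map_pow, aeval_X, aeval_C]
      field_simp
    have hR' : aeval x (mapRam a) = x ^ 3 * aeval x⁻¹ R' := by
      simp only [mapRam, R', map_mul, map_sub, aeval_X, aeval_C]
      field_simp
    have he : Y * aeval x (mapRam a) / aeval x (mapDen a) ^ 2 /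
        (aeval x (mapNum a) / aeval x (mapDen a)) ^ 2 =
        Y / x ^ 3 * (aeval x⁻¹ R' / aeval x⁻¹ N' ^ 2) := by
      have hN'0 : aeval x⁻¹ N' ≠ 0 := by
        intro h
        exact hN (by rw [hN', h, mul_zero])
      have h1 : Y * aeval x (mapRam a) / aeval x (mapDen a) ^ 2 /
          (aeval x (mapNum a) / aeval x (mapDen a)) ^ 2 =
          Y * aeval x (mapRam a) / aeval x (mapNum a) ^ 2 := by
        field_simp
      rw [h1, hN', hR']
      field_simp
    rw [takesValue_image, map_div₀, map_pow, hψX, hψY, he]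
    have h1 := hP.takesValue_mul hr (hP.takesValue_div (hP.takesValue_aeval ht R')
      (hP.takesValue_pow (hP.takesValue_aeval ht N') 2) (by simp [N']))
    convert h1 using 1
    simp [N', R']
    norm_num
  refine ⟨P₁, hP₁, image τ P₁, hP₂c.mem_points h₂ hxt.ne_zero', ?_,
    A.ramIndex_infinite M hψX hP₁c h₁, A.ramIndex_infinite M hψX hP₂c h₂, ?_⟩
  · intro heq
    have hv₁ := hval hP₁c ht₁ hy₁
    have hv₂ := hval hP₂c ht₂ hy₂
    rw [← heq] at hv₂
    have := (hP₁c.image ψ).takesValue_unique hv₁ hv₂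
    rw [sexticInfinity_eval_zero] at hy
    have hy0 : y = 0 := by linear_combination this / 2
    simp [hy0] at hy
  · intro P hP hne₁ hne₂
    have hPc : ContainsConstants P := hP.1
    by_cases hx : x ∈ P
    · obtain ⟨x₀, hx₀⟩ := M.exists_takesValue_x hPc hP.2 hx
      exact A.ramIndex_finite M hF hψX hψY hPc hx₀
    · exfalso
      have ht := takesValue_zero.2 (valuation_inv_lt_one hx)
      obtain ⟨w, hw⟩ := M'.exists_takesValue_Y hPc ht
      have hw2 := M'.eval_eq hPc ht hw
      have hsm : (sexticInfinity a c).eval 0 ≠ 0 ∨ (sexticInfinity a c).derivative.eval 0 ≠ 0 :=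
        Or.inl (by simp [sexticInfinity_eval_zero])
      rw [← hy] at hw2
      rcases sq_eq_sq_iff_eq_or_eq_neg.1 hw2 with rfl | rfl
      · exact hne₁ (M'.place_unique hPc ht hw hsm hP₁c ht₁ hy₁)
      · exact hne₂ (M'.place_unique hPc ht hw hsm hP₂c ht₂ hy₂)

end Sextic

/-- The hyperelliptic involution. -/
lemma exists_involution {F : ℂ[X]} (hF : Squarefree F) (hu : ¬ IsUnit F) :
    ∃ τ : CurveField F →ₐ[ℂ] CurveField F, τ (curveX F) = curveX F ∧ τ (curveY F) = -curveY F := by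
  obtain ⟨hirr, hroot⟩ := curveY_irreducible_aeval hF hu
  have hmin := minpoly.eq_of_irreducible_of_monic hirr hroot (monic_X_pow_sub_C _ two_ne_zero)
  have : Normal (RatFunc ℂ) (CurveField F) :=
    Normal.of_isSplittingField (X ^ 2 - C (algebraMap ℂ[X] (RatFunc ℂ) F))
  obtain ⟨σ, hσ⟩ := minpoly.exists_algEquiv_of_root' (K := RatFunc ℂ) (x := -curveY F)
    (y := curveY F) ⟨_, hirr.ne_zero, hroot⟩ (by
      rw [← hmin]
      simpa using hroot)
  exact ⟨(σ : CurveField F →ₐ[RatFunc ℂ] CurveField F).restrictScalars ℂ, σ.commutes _, hσ⟩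

theorem mainTheorem5 (a c t s : ℂ) (ha₁ : a - 1 ≠ 0) (ha₂ : 2 * a - 3 ≠ 0)
    (hC : Squarefree (sextic a c))
    (ht : t = a ^ 3 * (a - 2) / (2 * a - 3) ^ 3) (hs : s = 4 * c / (a - 1) ^ 2) :
    Squarefree (quartic t s) ∧ IsEllipticFunctionField (CurveField (quartic t s)) ∧
    ∃ ψ : CurveField (quartic t s) →ₐ[ℂ] CurveField (sextic a c),
      coverDegree ψ = 3 ∧ IsMaximalCover ψ ∧ IsGenericType ψ 3 := by
  have A := admissible ha₁ ha₂ hC ht hs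
  have hG := squarefree_quartic A.t_zero A.t_one A.s_zero A.s_one A.s_t
  refine ⟨hG, isElliptic_quartic A.t_zero A.t_one A.s_zero A.s_one A.s_t, ?_⟩
  obtain ⟨φ, hφ⟩ := exists_ratFunc_hom (A.map_transcendental ratFunc_transcendental)
  have hφ' : ((proj (sextic a c)).comp φ) RatFunc.X =
      aeval (curveX (sextic a c)) (mapNum a) / aeval (curveX (sextic a c)) (mapDen a) := by
    rw [AlgHom.comp_apply, hφ, map_div₀, ← Polynomial.aeval_algHom_apply,
      ← Polynomial.aeval_algHom_apply]
    rfl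
  have M₀ := curve_model (sextic a c)
  have hsq := A.quartic_pullback M₀
  rw [← hφ'] at hsq
  obtain ⟨ψ, hψ, hψY⟩ := exists_curve_hom (quartic t s) _ _ hsq
  have hψX : ψ (curveX (quartic t s)) =
      aeval (curveX (sextic a c)) (mapNum a) / aeval (curveX (sextic a c)) (mapDen a) := by
    rw [← hφ', ← hψ]
    rfl
  have hdegφ := A.coverDegree_map hφ
  have hdeg : coverDegree ψ = 3 := by
    have h := congrArg coverDegree hψ
    rw [coverDegree_comp, coverDegree_comp, coverDegree_proj hG quartic_not_isUnit,
      coverDegree_proj hC sextic_not_isUnit, hdegφ] at h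
    omega
  refine ⟨ψ, hdeg, ?_, ?_, φ, hψ, hdegφ, A.hasGenericRamification hφ (mem_branchPoints_iff hG)⟩
  · refine isMaximalCover_of_prime (by rw [hdeg]; exact Nat.prime_three) M₀
      (eval_or_derivative_ne_zero hC) (sextic_model_infinity M₀) ?_
    rw [sexticInfinity_eval_zero]
    exact one_ne_zero
  · obtain ⟨τ, hτX, hτY⟩ := exists_involution hC sextic_not_isUnit
    rcases hψY with h | h
    · exact A.isCaseOne M₀ hC hψX h τ hτX hτY
    · refine A.isCaseOne M₀.neg hC hψX ?_ τ hτX (by rw [map_neg, hτY])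
      rw [h]
      ring

end
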